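/- All graphs are finite and simple. A \emph{leaf} of a tree is a vertex of degree $1$, and a \emph{broom vertex} is a vertex adjacent to a leaf. For positive integers $a,b$, a \emph{double broom} $B(n,a,b)$ is a tree on $n$ vertices with exactly two broom vertices $x\neq y$, where $\deg(x)=a+1$ and $\deg(y)=b+1$. The \emph{Wiener index} of a connected graph $G$ is $W(G)=\sum_{\{u,v\}\subseteq V(G)}d(u,v)$, the sum of the distances between all unordered pairs of vertices. \textbf{Theorem.} Let $T$ be a tree of order $n$ and diameter $d$, where $$1636\le n\le d-2+4\left\lfloor\sqrt{\frac{d-1}{2}}\right\rfloor .$$ Then $T$ has maximum Wiener index among all trees of order $n$ and diameter $d$ if and only if $T$ is a double broom $B(n,a,b)$ whose leaves are distributed as evenly as possible between its two broom vertices, that is, with $|a-b|\le 1$. -/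

import Mathlib

universe u

namespace WienerTree

open Classical in
/-- The Wiener index: the sum of the distances over all unordered pairs of vertices.
The degenerate pairs `s(v, v)` in `Sym2 V` contribute `G.dist v v = 0`. -/
noncomputable def wienerIndex {V : Type u} [Fintype V] (G : SimpleGraph V) : ℕ :=
  ∑ p : Sym2 V, Sym2.lift ⟨fun x y => G.dist x y, fun _ _ => G.dist_comm⟩ p

open Classical in
/-- A leaf is a vertex of degree one. -/
def IsLeaf {V : Type u} [Fintype V] (G : SimpleGraph V) (v : V) : Prop :=
  G.degree v = 1

/-- A broom vertex is a vertex adjacent to a leaf. -/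
def IsBroomVertex {V : Type u} [Fintype V] (G : SimpleGraph V) (v : V) : Prop :=
  ∃ w, G.Adj v w ∧ IsLeaf G w

open Classical in
/-- `G` is a double broom `B(n, a, b)`, where `n` is the order of `G`: a tree with exactly two
broom vertices `x` and `y`, of degrees `a + 1` and `b + 1`, where `a` and `b` are positive. -/
def IsDoubleBroom {V : Type u} [Fintype V] (G : SimpleGraph V) (a b : ℕ) : Prop :=
  G.IsTree ∧ 0 < a ∧ 0 < b ∧
    ∃ x y : V, x ≠ y ∧ (∀ v, IsBroomVertex G v ↔ v = x ∨ v = y) ∧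
      G.degree x = a + 1 ∧ G.degree y = b + 1

/-- The tree `T` has order `n` and diameter `d`. -/
def IsTreeOfOrderDiam {V : Type u} [Fintype V] (T : SimpleGraph V) (n d : ℕ) : Prop :=
  T.IsTree ∧ Fintype.card V = n ∧ T.diam = d

/-- `T` has maximum Wiener index among all trees of order `n` and diameter `d`. -/
def HasMaxWienerIndex {V : Type u} [Fintype V] (T : SimpleGraph V) (n d : ℕ) : Prop :=
  IsTreeOfOrderDiam T n d ∧
    ∀ (V' : Type u) [Fintype V'] (T' : SimpleGraph V'),
      IsTreeOfOrderDiam T' n d → wienerIndex T' ≤ wienerIndex T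

end WienerTree

/-! Root `T` at a middle vertex `r` of a longest path. In a tree the Wiener index is `n` times the
sum of the depths minus the sum of the squared descendant counts of the vertices other than `r`;
only `≤` is needed (`wienerIndex_add_sum_sq_le`). These vertices form two sides: the branch
containing one half of the longest path, and all the rest. On one level of one side the descendant
counts add up to the number `S` of vertices at that depth or deeper, so by Cauchy–Schwarz their
squares sum to at least `S ^ 2` over the level size (`branch_sum_le`).

On each side, move all but one vertex of every level above the deepest one down to the deepest one.
This gives a double broom with, say, `A` and `B` leaves; let `P` and `Q` be the numbers of vertices
moved. Summing over levels, the Wiener index of `T` is at most `broomIndex d A B + P * ((A + 1) ^ 2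
/ 2 + 1 - n)` plus the analogous term for `Q` (`sum_level_le`, `IsSplit.wienerIndex_le`).

The upper bound on `n` implies `(A + B + 1) ^ 2 ≤ 8 * (d - 1)`. If `|A - B| ≤ 1`, both coefficients
are therefore negative. If, say, `A ≥ B + 2`, the coefficient of `P` may be positive, but the loss
of `broomIndex` against the balanced broom, at least `(d - 2) * ((A - B) ^ 2 - 1) / 4`, outweighs it
(`surplus_lt_deficit`). So the balanced value is an upper bound, reached only if `P = Q = 0` and `|A
- B| ≤ 1`; then every level above the deepest has one vertex per side and `T` is a double broom.

Conversely, double brooms reach their `broomIndex` (`broomIndex_le_of_isDoubleBroom`) and balanced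
ones exist (`exists_isBroomProfile`). -/

namespace WienerTree

/-! ### Numerical inequalities for level sizes and broom indices -/

/-- The contribution of one half of a double broom to the Wiener index: a path of `c - 1` edges
with `A` leaves at its end, in a tree of order `n`. -/
def halfBroom (n c A : ℚ) : ℚ :=
  A * (n - 1) + (c - 1) * A * (n - A) + (n - 2 * A) * c * (c - 1) / 2
    - (c - 1) * c * (2 * c - 1) / 6

/-- The Wiener index of a double broom of diameter `d` with `A` and `B` leaves. -/
def broomIndex (d A B : ℚ) : ℚ :=
  (A + B) * (A + B + d - 2) + (d - 2) * A * B + (A + B) * (d - 1) * (d - 2) / 2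
    + d * (d - 1) * (d - 2) / 6

/-- The position `c` of the root cancels, so the root may be put where the estimates work best. -/
theorem halfBroom_add_halfBroom (c d A B : ℚ) :
    halfBroom (A + B + d - 1) c A + halfBroom (A + B + d - 1) (d - c) B = broomIndex d A B := by
  unfold halfBroom broomIndex
  ring

theorem broomIndex_comm (d A B : ℚ) : broomIndex d A B = broomIndex d B A := by
  unfold broomIndex
  ring

/-- The convex function `1 / (1 + q)` lies above its chord `(2 - q) / 2` through `q = 0` and `q = 1`
at all natural `q`. The chord keeps the estimate polynomial and exact for levels of size one and
two. -/
theorem two_sub_mul_sq_le {q S M : ℕ} (h : S ^ 2 ≤ (1 + q) * M) :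
    (2 - (q : ℚ)) * (S : ℚ) ^ 2 ≤ 2 * M := by
  have h' : (S : ℚ) ^ 2 ≤ (1 + q) * M := by exact_mod_cast h
  have hM : (0 : ℚ) ≤ M := by positivity
  have hS : (0 : ℚ) ≤ (S : ℚ) ^ 2 := by positivity
  rcases q with _ | _ | q
  · push_cast at h' ⊢; linarith
  · push_cast at h' ⊢; linarith
  · push_cast at h' ⊢
    have hq : (0 : ℚ) ≤ q := by positivity
    nlinarith

/-- One level of size `1 + q` on top of a half with `A` leaves: its `q` extra vertices are traded
for leaves, at the cost of the last term. The error is an explicit product, nonnegative because `n`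
is large against `A + q` and `c`. -/
theorem halfBroom_step {n c A q S M : ℚ} (hc : 1 ≤ c) (hq : q = 0 ∨ 1 ≤ q) (hS : S = A + q + c)
    (hM : (2 - q) * S ^ 2 ≤ 2 * M) (hn : 6 * (A + q) + 3 * (c + 1) + 1 ≤ 2 * n) :
    n * S - M ≤ halfBroom n (c + 1) (A + q) - halfBroom n c A
      + q * ((A + q + 1) ^ 2 / 2 + 1 - n) := by
  subst hS
  have key : halfBroom n (c + 1) (A + q) - halfBroom n c A
      + q * ((A + q + 1) ^ 2 / 2 + 1 - n) - (n * (A + q + c) - (2 - q) * (A + q + c) ^ 2 / 2)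
      = q * (c - 1) * (n + q - 3 * (A + q) - 3 * c / 2 - 1 / 2) := by
    unfold halfBroom
    ring
  have h0 : 0 ≤ q * (c - 1) * (n + q - 3 * (A + q) - 3 * c / 2 - 1 / 2) := by
    rcases hq with rfl | hq
    · simp
    · apply mul_nonneg
      · apply mul_nonneg <;> linarith
      · linarith
  linarith

-- Levels are indexed from the deepest upwards: `r i` is the size of level `i` and `M i` the sum of
-- its squared descendant counts. `A - r 0` is the number of extra vertices above the deepest level.
open Finset in
theorem sum_level_le (n : ℕ) (r M : ℕ → ℕ) (c : ℕ) (hr : ∀ i ≤ c, 1 ≤ r i)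
    (hM : ∀ i ≤ c, (∑ j ∈ range (i + 1), r j) ^ 2 ≤ r i * M i) (A : ℕ)
    (hA : ∑ j ∈ range (c + 1), r j = A + c) (hn : 6 * A + 3 * (c + 1) + 1 ≤ 2 * n) :
    r 0 ≤ A ∧ ∑ i ∈ range (c + 1), ((n : ℚ) * (∑ j ∈ range (i + 1), r j : ℕ) - M i) ≤
      halfBroom n (c + 1) A + (A - r 0) * (((A : ℚ) + 1) ^ 2 / 2 + 1 - n) := by
  induction c generalizing A with
  | zero =>
    have h0 := hM 0 le_rfl
    have h1 := hr 0 le_rfl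
    simp only [zero_add, sum_range_one, add_zero] at hA h0 ⊢
    subst hA
    refine ⟨le_rfl, ?_⟩
    have : r 0 ≤ M 0 := by
      rw [sq] at h0
      exact Nat.le_of_mul_le_mul_left h0 h1
    have : (r 0 : ℚ) ≤ M 0 := by exact_mod_cast this
    simp only [halfBroom, Nat.cast_zero]
    linarith
  | succ c ih =>
    obtain ⟨q, hq⟩ := Nat.exists_eq_add_of_le (hr (c + 1) le_rfl)
    have hlow : c + 1 ≤ ∑ j ∈ range (c + 1), r j := by
      calc c + 1 = ∑ j ∈ range (c + 1), 1 := by simp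
        _ ≤ _ := sum_le_sum fun j hj => hr j (by simp at hj; omega)
    have hA' := hA
    rw [sum_range_succ] at hA
    obtain ⟨A₀, hA₀⟩ := Nat.exists_eq_add_of_le (show c ≤ ∑ j ∈ range (c + 1), r j by omega)
    obtain ⟨h0, h1⟩ := ih (fun i hi => hr i (by omega)) (fun i hi => hM i (by omega)) A₀
      (by omega) (by omega)
    have hAq : A = A₀ + q := by omega
    subst hAq
    refine ⟨by omega, ?_⟩
    rw [sum_range_succ]
    have h2 := hM (c + 1) le_rfl
    rw [hq] at h2
    have h3 := two_sub_mul_sq_le h2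
    have h4 := halfBroom_step (n := n) (c := c + 1) (A := A₀) (q := q)
      (S := (∑ j ∈ range (c + 1 + 1), r j : ℕ)) (M := M (c + 1)) (by linarith [Nat.cast_nonneg (α := ℚ) c])
      (by rcases Nat.eq_zero_or_pos q with h | h
          · left; simp [h]
          · right; exact_mod_cast h)
      (by rw [hA']; push_cast; ring) h3 (by exact_mod_cast hn)
    have h5 : (r 0 : ℚ) ≤ A₀ := by exact_mod_cast h0
    -- The coefficient grows with the number of leaves, so the surplus collected so far may be
    -- charged at the new, larger rate.
    have h6 : ((A₀ : ℚ) - r 0) * (((A₀ : ℚ) + 1) ^ 2 / 2 + 1 - n)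
        ≤ (A₀ - r 0) * (((A₀ : ℚ) + q + 1) ^ 2 / 2 + 1 - n) := by
      apply mul_le_mul_of_nonneg_left _ (by linarith)
      have : (0 : ℚ) ≤ q := by positivity
      have : (0 : ℚ) ≤ A₀ := by positivity
      nlinarith
    push_cast at h1 h4 ⊢
    linarith


/-- Used with `D = d - 1`, `u = A + B + 1` and `w = A - B + 1`. Then `(u + w) / 2 = A + 1` and `w *
(w - 2) = (A - B) ^ 2 - 1`, so the two sides are the gain from the surplus and the loss from
imbalance. -/
theorem surplus_lt_deficit {D u w : ℚ} (hD : 1500 ≤ D) (huD : u ^ 2 ≤ 8 * D) (hw : 3 ≤ w)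
    (hwu : w ≤ u) {P : ℚ} (hP0 : 0 ≤ P) (hP : 2 * P ≤ u + w) :
    P * ((u + w) ^ 2 / 8 + 2 - D - u) < (D - 1) * (w * (w - 2)) / 4 := by
  have hpos : 0 < (D - 1) * (w * (w - 2)) / 4 := by
    apply div_pos _ (by norm_num)
    exact mul_pos (by linarith) (mul_pos (by linarith) (by linarith))
  rcases le_or_gt ((u + w) ^ 2 / 8 + 2 - D - u) 0 with h | h
  · exact lt_of_le_of_lt (mul_nonpos_of_nonneg_of_nonpos hP0 h) hpos
  -- A positive coefficient together with `w ≤ u` gives `u ^ 2 / 2 + 2 > D + u ≥ 1500 + u`. After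
  -- that `D` is replaced by its least value `u ^ 2 / 8`, and the gap is expanded around `u = 40`.
  have hu : 40 ≤ u := by
    by_contra hu
    push Not at hu
    nlinarith
  have h1 : P * ((u + w) ^ 2 / 8 + 2 - D - u)
      ≤ (u + w) / 2 * ((u + w) ^ 2 / 8 + 2 - u ^ 2 / 8 - u) := by
    apply mul_le_mul (by linarith) (by linarith) h.le (by linarith)
  have h2 : (u ^ 2 / 8 - 1) * (w * (w - 2)) / 4 ≤ (D - 1) * (w * (w - 2)) / 4 := by
    have : 0 ≤ w * (w - 2) := mul_nonneg (by linarith) (by linarith)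
    have := mul_le_mul_of_nonneg_right (show u ^ 2 / 8 - 1 ≤ D - 1 by linarith) this
    linarith
  have h3 : 4 * ((u ^ 2 / 8 - 1) * (w * (w - 2)) / 4
        - (u + w) / 2 * ((u + w) ^ 2 / 8 + 2 - u ^ 2 / 8 - u))
      = (u - 40) * u * ((w - 3) ^ 2 + 7) / 8 + (u - w) * w ^ 2 / 4
        + (u - 40) * (4 * w ^ 2 - 28 * w + 76) + (159 * w ^ 2 - 1122 * w + 3040) := by
    ring
  have h4 : 0 ≤ (u - 40) * u * ((w - 3) ^ 2 + 7) / 8 := by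
    have : 0 ≤ (u - 40) * u := mul_nonneg (by linarith) (by linarith)
    positivity
  have h5 : 0 ≤ (u - w) * w ^ 2 / 4 := by
    have : 0 ≤ u - w := by linarith
    positivity
  have h6 : 0 ≤ (u - 40) * (4 * w ^ 2 - 28 * w + 76) :=
    mul_nonneg (by linarith) (by nlinarith [sq_nonneg (2 * w - 7)])
  have h7 : 0 < 159 * w ^ 2 - 1122 * w + 3040 := by nlinarith [sq_nonneg (w - 7 / 2)]
  linarith

theorem broomIndex_add_surplus_aux {d A B A₀ B₀ P Q : ℕ} (hd : 1501 ≤ d)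
    (hs : (A + B + 1) ^ 2 ≤ 8 * (d - 1)) (hP : P + 1 ≤ A) (hQ : Q + 1 ≤ B)
    (h0 : A₀ + B₀ = A + B) (hAB₀ : |(A₀ : ℤ) - B₀| ≤ 1) (hBA : B ≤ A) :
    broomIndex d A B + P * (((A : ℚ) + 1) ^ 2 / 2 + 1 - (A + B + d - 1))
        + Q * (((B : ℚ) + 1) ^ 2 / 2 + 1 - (A + B + d - 1)) < broomIndex d A₀ B₀ ∨
      (P = 0 ∧ Q = 0 ∧ |(A : ℤ) - B| ≤ 1) := by
  have hs' : ((A : ℚ) + B + 1) ^ 2 ≤ 8 * (d - 1) := by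
    have : ((A : ℤ) + B + 1) ^ 2 ≤ 8 * (d - 1) := by
      zify [show 1 ≤ d by omega] at hs
      exact hs
    exact_mod_cast this
  have hd' : (1501 : ℚ) ≤ d := by exact_mod_cast hd
  have hP' : (P : ℚ) + 1 ≤ A := by exact_mod_cast hP
  have hQ' : (Q : ℚ) + 1 ≤ B := by exact_mod_cast hQ
  have hP0 : (0 : ℚ) ≤ P := by positivity
  have hQ0 : (0 : ℚ) ≤ Q := by positivity
  have hBA' : (B : ℚ) ≤ A := by exact_mod_cast hBA
  have hgB : ((B : ℚ) + 1) ^ 2 / 2 + 1 - (A + B + d - 1) < 0 := by nlinarith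
  rcases le_or_gt A (B + 1) with hz | hz
  · have hz' : (A : ℚ) ≤ B + 1 := by exact_mod_cast hz
    have hgA : ((A : ℚ) + 1) ^ 2 / 2 + 1 - (A + B + d - 1) < 0 := by
      -- From `2 * (A + 1) ≤ A + B + 3` the bound `hs'` suffices once `A + B ≥ 5`; for fewer leaves
      -- the size of `d` does.
      rcases le_or_gt 5 (A + B) with h | h
      · have h : (5 : ℚ) ≤ A + B := by exact_mod_cast h
        nlinarith
      · have h : (A : ℚ) ≤ 3 := by exact_mod_cast (show A ≤ 3 by omega)
        nlinarith
    have heq : broomIndex d A B = broomIndex d A₀ B₀ := by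
      have : (A₀ = A ∧ B₀ = B) ∨ (A₀ = B ∧ B₀ = A) := by
        rw [abs_le] at hAB₀
        omega
      rcases this with ⟨rfl, rfl⟩ | ⟨rfl, rfl⟩
      · rfl
      · exact broomIndex_comm _ _ _
    by_cases h : P = 0 ∧ Q = 0
    · right
      refine ⟨h.1, h.2, ?_⟩
      rw [abs_le]
      omega
    · left
      rw [heq]
      rcases Nat.eq_zero_or_pos P with hP1 | hP1
      · have hQ1 : 0 < Q := by omega
        have hQ1 : (0 : ℚ) < Q := by exact_mod_cast hQ1
        have := mul_neg_of_pos_of_neg hQ1 hgB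
        simp only [hP1, Nat.cast_zero, zero_mul]
        linarith
      · have hP1 : (0 : ℚ) < P := by exact_mod_cast hP1
        have := mul_neg_of_pos_of_neg hP1 hgA
        have := mul_nonpos_of_nonneg_of_nonpos hQ0 hgB.le
        linarith
  · left
    have hz' : (B : ℚ) + 2 ≤ A := by exact_mod_cast hz
    have h1 := surplus_lt_deficit (D := d - 1) (u := A + B + 1) (w := A - B + 1) (P := P)
      (by linarith) hs' (by linarith) (by linarith) hP0 (by linarith)
    have h2 := mul_nonpos_of_nonneg_of_nonpos hQ0 hgB.le
    have h3 : ((A₀ : ℚ) - B₀) ^ 2 ≤ 1 := by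
      have : |(A₀ : ℚ) - B₀| ≤ 1 := by exact_mod_cast hAB₀
      rw [← sq_abs]
      have := abs_nonneg ((A₀ : ℚ) - B₀)
      nlinarith
    have h0' : (A₀ : ℚ) = A + B - B₀ := by
      have : (A₀ : ℚ) + B₀ = A + B := by exact_mod_cast h0
      linarith
    have h4 : 4 * (broomIndex d A₀ B₀ - broomIndex d A B)
        = (d - 2) * (((A : ℚ) - B) ^ 2 - (A₀ - B₀) ^ 2) := by
      unfold broomIndex
      rw [h0']
      ring
    have h5 : ((d : ℚ) - 2) * ((A - B) ^ 2 - 1) ≤ (d - 2) * (((A : ℚ) - B) ^ 2 - (A₀ - B₀) ^ 2) :=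
      mul_le_mul_of_nonneg_left (by linarith) (by linarith)
    have h6 : P * (((A : ℚ) + 1) ^ 2 / 2 + 1 - (A + B + d - 1))
        = P * (((A : ℚ) + B + 1 + (A - B + 1)) ^ 2 / 8 + 2 - (d - 1) - (A + B + 1)) := by
      ring
    have h7 : ((d : ℚ) - 1 - 1) * ((A - B + 1) * (A - B + 1 - 2)) / 4
      = (d - 2) * ((A - B) ^ 2 - 1) / 4 := by ring
    linarith

/-- A tree with surplus `P` and `Q` on its two sides loses against the balanced double broom. -/
theorem broomIndex_add_surplus {d A B A₀ B₀ P Q : ℕ} (hd : 1501 ≤ d)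
    (hs : (A + B + 1) ^ 2 ≤ 8 * (d - 1)) (hP : P + 1 ≤ A) (hQ : Q + 1 ≤ B)
    (h0 : A₀ + B₀ = A + B) (hAB₀ : |(A₀ : ℤ) - B₀| ≤ 1) :
    broomIndex d A B + P * (((A : ℚ) + 1) ^ 2 / 2 + 1 - (A + B + d - 1))
        + Q * (((B : ℚ) + 1) ^ 2 / 2 + 1 - (A + B + d - 1)) < broomIndex d A₀ B₀ ∨
      (P = 0 ∧ Q = 0 ∧ |(A : ℤ) - B| ≤ 1) := by
  rcases le_total B A with h | h
  · exact broomIndex_add_surplus_aux hd hs hP hQ h0 hAB₀ h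
  · rcases broomIndex_add_surplus_aux hd (by rwa [add_comm B A]) hQ hP
      (by omega : A₀ + B₀ = B + A) hAB₀ h with h | ⟨h1, h2, h3⟩
    · left
      rw [broomIndex_comm d A B, add_comm (A : ℚ) B]
      linarith
    · exact Or.inr ⟨h2, h1, by rwa [abs_sub_comm]⟩

theorem diam_bounds {n d s : ℕ} (hs : s + d = n + 1) (hs2 : 2 ≤ s)
    (hnd : (n : ℤ) ≤ (d : ℤ) - 2 + 4 * ⌊√(((d : ℝ) - 1) / 2)⌋) (hn : 1636 ≤ n) :
    1501 ≤ d ∧ (s + 1) ^ 2 ≤ 8 * (d - 1) := by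
  set k := ⌊√(((d : ℝ) - 1) / 2)⌋ with hk
  have hk1 : (k : ℝ) ≤ √(((d : ℝ) - 1) / 2) := Int.floor_le _
  have hk0 : 1 ≤ k := by omega
  have hk0' : (1 : ℝ) ≤ k := by exact_mod_cast hk0
  have hk2 : (k : ℝ) ^ 2 ≤ ((d : ℝ) - 1) / 2 := by
    rw [← Real.le_sqrt' (by linarith)]
    exact hk1
  have hk3 : 2 * k ^ 2 ≤ (d : ℤ) - 1 := by
    have : 2 * (k : ℝ) ^ 2 ≤ (d : ℝ) - 1 := by linarith
    exact_mod_cast this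
  have h1 : ((s : ℤ) + 1) ≤ 4 * k := by omega
  have h2 : ((s : ℤ) + 1) ^ 2 ≤ 8 * ((d : ℤ) - 1) := by nlinarith
  have hd1 : 1 ≤ d := by
    by_contra h
    have : d = 0 := by omega
    subst this
    nlinarith
  refine ⟨?_, ?_⟩
  -- If `d ≤ 1500`, then `(s + 1) ^ 2 ≤ 8 * 1499` gives `s + 1 ≤ 109`, hence `n = s + d - 1 ≤ 1607`.
  · by_contra h
    have h3 : (s : ℤ) ≥ 136 := by omega
    have h4 : (d : ℤ) ≤ 1500 := by omega
    nlinarith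
  · zify [hd1]
    exact h2


open SimpleGraph

/-! ### Ancestors and distances in a rooted tree -/

section Tree

variable {V : Type u} {T : SimpleGraph V}

/-- In the graph `T` rooted at `r`, the vertex `w` is an ancestor of `v` (or `v` itself):
it lies on a geodesic from `r` to `v`. -/
def IsAncestor (T : SimpleGraph V) (r w v : V) : Prop :=
  T.dist r v = T.dist r w + T.dist w v

theorem IsAncestor.refl (T : SimpleGraph V) (r v : V) : IsAncestor T r v v := by
  simp [IsAncestor]

theorem IsAncestor.dist_le {r w v : V} (h : IsAncestor T r w v) : T.dist r w ≤ T.dist r v := by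
  unfold IsAncestor at h
  omega

theorem IsAncestor.trans (hT : T.Connected) {r x w v : V} (h₁ : IsAncestor T r x w)
    (h₂ : IsAncestor T r w v) : IsAncestor T r x v := by
  unfold IsAncestor at *
  have := hT.dist_triangle (u := x) (v := w) (w := v)
  have := hT.dist_triangle (u := r) (v := x) (w := v)
  omega

theorem exists_isAncestor (hT : T.Connected) (r v : V) {j : ℕ} (hj : j ≤ T.dist r v) :
    ∃ w, T.dist r w = j ∧ IsAncestor T r w v := by
  obtain ⟨p, hp⟩ := hT.exists_walk_length_eq_dist r v
  refine ⟨p.getVert j, ?_⟩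
  have h1 := dist_le (p.take j)
  have h2 := dist_le (p.drop j)
  rw [Walk.take_length] at h1
  rw [Walk.drop_length] at h2
  have := hT.dist_triangle (u := r) (v := p.getVert j) (w := v)
  unfold IsAncestor
  omega

/-- Geodesics through `w` and through `w'` are both the unique path from `r` to `v`, and each vertex
is found on it at its depth. -/
theorem IsAncestor.eq_of_dist_eq (hT : T.IsTree) {r w w' v : V} (h : IsAncestor T r w v)
    (h' : IsAncestor T r w' v) (hd : T.dist r w = T.dist r w') : w = w' := by
  have key : ∀ x, IsAncestor T r x v → ∃ p : T.Path r v, p.1.getVert (T.dist r x) = x := by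
    intro x hx
    obtain ⟨p, hp⟩ := hT.connected.exists_walk_length_eq_dist r x
    obtain ⟨q, hq⟩ := hT.connected.exists_walk_length_eq_dist x v
    have hl : (p.append q).length = T.dist r v := by
      rw [Walk.length_append, hp, hq, hx]
    refine ⟨⟨p.append q, (p.append q).isPath_of_length_eq_dist hl⟩, ?_⟩
    simp [Walk.getVert_append, ← hp]
  obtain ⟨p, hp⟩ := key w h
  obtain ⟨p', hp'⟩ := key w' h'
  rw [← hp, ← hp', (hT.isAcyclic.subsingleton_path r v).elim p p', hd]

theorem IsAncestor.of_dist_le (hT : T.IsTree) {r x w v : V} (hx : IsAncestor T r x v)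
    (hw : IsAncestor T r w v) (hd : T.dist r x ≤ T.dist r w) : IsAncestor T r x w := by
  obtain ⟨y, hy, hyw⟩ := exists_isAncestor hT.connected r w hd
  rwa [hx.eq_of_dist_eq hT (hyw.trans hT.connected hw) hy.symm]

theorem IsAncestor.eq_of_dist_le {r w v : V} (hT : T.Connected) (h : IsAncestor T r w v)
    (hd : T.dist r v ≤ T.dist r w) : w = v := by
  unfold IsAncestor at h
  exact hT.dist_eq_zero_iff.1 (by omega)

/-- Walking across an edge `x y` away from `u` towards `v`. -/
theorem dist_eq_of_adj_between (hT : T.IsTree) {u v x y : V} (hxy : T.Adj x y)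
    (hu : T.dist u y = T.dist u x + 1) (hv : T.dist v x = T.dist v y + 1) :
    T.dist u v = T.dist u x + 1 + T.dist v y := by
  obtain ⟨p, hp⟩ := hT.connected.exists_walk_length_eq_dist u x
  obtain ⟨q, hq⟩ := hT.connected.exists_walk_length_eq_dist y v
  have hpp := p.isPath_of_length_eq_dist hp
  have hqp := q.isPath_of_length_eq_dist hq
  -- A common vertex of the two geodesics would be strictly nearer to `x` than to `y`, and also the
  -- other way round.
  have hmem : ∀ z ∈ p.support, z ∉ q.support := by
    intro z hz hz'
    obtain ⟨i, rfl, hi⟩ := Walk.mem_support_iff_exists_getVert.1 hz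
    obtain ⟨k, hk, hk'⟩ := Walk.mem_support_iff_exists_getVert.1 hz'
    have h1 := dist_le (p.take i)
    have h2 := dist_le (p.drop i)
    rw [Walk.take_length] at h1
    rw [Walk.drop_length] at h2
    have h3 := dist_le (q.take k)
    have h4 := dist_le (q.drop k)
    rw [Walk.take_length] at h3
    rw [Walk.drop_length] at h4
    rw [hk] at h3 h4
    have h5 := hT.connected.dist_triangle (u := u) (v := p.getVert i) (w := y)
    have h6 := hT.connected.dist_triangle (u := v) (v := p.getVert i) (w := x)
    rw [dist_comm (u := y)] at h3 hq
    rw [dist_comm (v := v)] at h4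
    omega
  have hpath : (p.append (Walk.cons hxy q)).IsPath := by
    rw [Walk.isPath_def, Walk.support_append, List.nodup_append]
    refine ⟨hpp.support_nodup, by simpa using hqp.support_nodup, ?_⟩
    rintro a ha b hb rfl
    exact hmem a ha (by simpa using hb)
  obtain ⟨w, hw⟩ := hT.connected.exists_walk_length_eq_dist u v
  have huniq := (hT.isAcyclic.subsingleton_path u v).elim ⟨_, hpath⟩
    ⟨w, w.isPath_of_length_eq_dist hw⟩
  have hlen := congrArg (fun P : T.Path u v => P.1.length) huniq
  simp only [Walk.length_append, Walk.length_cons] at hlen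
  rw [dist_comm (u := v)]
  omega

theorem dist_le_of_isAncestor (hT : T.Connected) {r m u v : V} (hu : IsAncestor T r m u)
    (hv : IsAncestor T r m v) : T.dist u v + 2 * T.dist r m ≤ T.dist r u + T.dist r v := by
  have := hT.dist_triangle (u := u) (v := m) (w := v)
  rw [dist_comm (u := u) (v := m)] at this
  unfold IsAncestor at *
  omega

theorem adj_iff_isAncestor (hT : T.IsTree) {r u v : V} :
    T.Adj u v ↔ (IsAncestor T r u v ∧ T.dist r v = T.dist r u + 1) ∨
      (IsAncestor T r v u ∧ T.dist r u = T.dist r v + 1) := by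
  constructor
  · intro h
    have h1 := dist_eq_one_iff_adj.2 h
    have h2 := dist_eq_one_iff_adj.2 h.symm
    unfold IsAncestor
    rcases hT.dist_eq_dist_add_one_of_adj r h with h | h
    · right; omega
    · left; omega
  · unfold IsAncestor
    rintro (⟨h1, h2⟩ | ⟨h1, h2⟩)
    · exact dist_eq_one_iff_adj.1 (by omega)
    · exact (dist_eq_one_iff_adj.1 (by omega)).symm

end Tree

open SimpleGraph Finset

/-! ### Descendant counts and the contribution of one side -/

section Wiener

variable {V : Type u} [Fintype V] {T : SimpleGraph V}

open Classical in
theorem two_mul_wienerIndex (G : SimpleGraph V) :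
    2 * wienerIndex G = ∑ u : V, ∑ v : V, G.dist u v := by
  unfold wienerIndex
  rw [← Fintype.sum_prod_type' (f := fun u v => G.dist u v),
    ← Finset.sum_fiberwise_of_maps_to (s := univ) (t := univ)
      (g := fun x : V × V => s(x.1, x.2)) (fun _ _ => mem_univ _), Finset.mul_sum]
  refine Finset.sum_congr rfl fun p _ => ?_
  induction p with
  | _ x y =>
    have : (univ.filter fun z : V × V => s(z.1, z.2) = s(x, y)) = {(x, y), (y, x)} := by
      ext ⟨a, b⟩
      simp
    rw [this]
    by_cases hxy : x = y
    · subst hxy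
      simp
    · rw [Finset.sum_pair (by simp [hxy])]
      simp only [Sym2.lift_mk]
      rw [dist_comm (u := y)]
      ring

open Classical in
/-- The number of descendants of `w`, including `w`, in `T` rooted at `r`. -/
noncomputable def descCard (T : SimpleGraph V) (r w : V) : ℕ :=
  #{v | IsAncestor T r w v}

-- The common ancestors of `u` and `v` other than `r` have distinct depths between `1` and the depth
-- of the deepest one `m`, and the route from `u` to `v` through `m` avoids the part above `m`
-- twice.
open Classical in
theorem dist_add_two_mul_card_le (hT : T.IsTree) (r u v : V) :
    T.dist u v + 2 * #{w | w ≠ r ∧ IsAncestor T r w u ∧ IsAncestor T r w v} ≤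
      T.dist r u + T.dist r v := by
  obtain ⟨m, hm, hmax⟩ := exists_max_image
    ({w | IsAncestor T r w u ∧ IsAncestor T r w v} : Finset V) (T.dist r)
    ⟨r, by rw [mem_filter_univ]; simp [IsAncestor]⟩
  simp only [mem_filter_univ] at hm hmax
  have hcard : #{w | w ≠ r ∧ IsAncestor T r w u ∧ IsAncestor T r w v} ≤ #(Icc 1 (T.dist r m)) := by
    refine card_le_card_of_injOn (T.dist r) ?_ ?_
    · intro w hw
      simp only [coe_filter, mem_univ, true_and, Set.mem_ofPred_eq] at hw
      have := hmax w hw.2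
      have := hT.connected.pos_dist_of_ne (Ne.symm hw.1)
      simp only [coe_Icc, Set.mem_Icc]
      omega
    · intro w hw w' hw' h
      simp only [coe_filter, mem_univ, true_and, Set.mem_ofPred_eq] at hw hw'
      exact hw.2.1.eq_of_dist_eq hT hw'.2.1 h
  rw [Nat.card_Icc, Nat.add_sub_cancel] at hcard
  have := dist_le_of_isAncestor hT.connected hm.1 hm.2
  omega

-- Sum the previous bound over ordered pairs: a vertex `w` is a common ancestor of `descCard T r w ^
-- 2` of them.
open Classical in
theorem wienerIndex_add_sum_sq_le (hT : T.IsTree) (r : V) :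
    wienerIndex T + ∑ w with w ≠ r, descCard T r w ^ 2 ≤
      Fintype.card V * ∑ v : V, T.dist r v := by
  have h1 : ∑ u : V, ∑ v : V,
      (T.dist u v + 2 * #{w | w ≠ r ∧ IsAncestor T r w u ∧ IsAncestor T r w v}) ≤
      ∑ u : V, ∑ v : V, (T.dist r u + T.dist r v) :=
    sum_le_sum fun u _ => sum_le_sum fun v _ => dist_add_two_mul_card_le hT r u v
  have h2 : ∑ u : V, ∑ v : V, (T.dist r u + T.dist r v)
      = 2 * (Fintype.card V * ∑ v : V, T.dist r v) := by
    simp only [sum_add_distrib, sum_const, card_univ, smul_eq_mul, ← mul_sum]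
    ring
  have h3 : ∑ u : V, ∑ v : V, #{w | w ≠ r ∧ IsAncestor T r w u ∧ IsAncestor T r w v}
      = ∑ w with w ≠ r, descCard T r w ^ 2 := by
    have : ∀ u v : V, #{w | w ≠ r ∧ IsAncestor T r w u ∧ IsAncestor T r w v}
        = ∑ w with w ≠ r,
          (if IsAncestor T r w u then 1 else 0) * (if IsAncestor T r w v then 1 else 0) := by
      intro u v
      simp only [card_filter, sum_filter]
      refine sum_congr rfl fun w _ => ?_
      split_ifs <;> simp_all
    simp only [this]
    rw [sum_congr rfl fun u _ => sum_comm, sum_comm]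
    refine sum_congr rfl fun w _ => ?_
    rw [← sum_mul_sum, descCard, card_filter, sq]
  simp only [sum_add_distrib, ← mul_sum] at h1 h2
  rw [h3, h2, ← two_mul_wienerIndex] at h1
  omega

-- Every vertex of depth at least `j` has exactly one ancestor at depth `j`.
open Classical in
theorem sum_descCard_level (hT : T.IsTree) {r : V} {X : Finset V}
    (hdesc : ∀ w ∈ X, ∀ v, IsAncestor T r w v → v ∈ X)
    (hanc : ∀ v ∈ X, ∀ w, w ≠ r → IsAncestor T r w v → w ∈ X) {j : ℕ} (hj : 1 ≤ j) :
    ∑ w ∈ X with T.dist r w = j, descCard T r w = #{v ∈ X | j ≤ T.dist r v} := by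
  unfold descCard
  have := sum_card_bipartiteAbove_eq_sum_card_bipartiteBelow (IsAncestor T r)
    (s := {w ∈ X | T.dist r w = j}) (t := univ)
  simp only [bipartiteAbove, bipartiteBelow] at this
  have hfil : {v ∈ X | j ≤ T.dist r v} = ({v | v ∈ X ∧ j ≤ T.dist r v} : Finset V) := by
    ext
    simp
  rw [this, hfil, card_filter]
  refine sum_congr rfl fun v _ => ?_
  split_ifs with hv
  · obtain ⟨w, hw, hwv⟩ := exists_isAncestor hT.connected r v hv.2
    rw [card_eq_one]
    refine ⟨w, ?_⟩
    ext w'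
    simp only [mem_filter, mem_singleton]
    constructor
    · rintro ⟨⟨_, h1⟩, h2⟩
      exact h2.eq_of_dist_eq hT hwv (h1.trans hw.symm)
    · rintro rfl
      have hr : w' ≠ r := by
        rintro rfl
        rw [dist_self] at hw
        omega
      exact ⟨⟨hanc v hv.1 w' hr hwv, hw⟩, hwv⟩
  · rw [card_eq_zero, filter_eq_empty_iff]
    intro w hw hwv
    simp only [mem_filter] at hw
    have := hwv.dist_le
    exact hv ⟨hdesc w hw.1 v hwv, by omega⟩

open Classical in
/-- The contribution to the Wiener index of a union `X` of branches at the root all of whose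
vertices have depth at most `c + 1`. -/
theorem branch_sum_le (hT : T.IsTree) {r : V} {X : Finset V} (hrX : r ∉ X)
    (hdesc : ∀ w ∈ X, ∀ v, IsAncestor T r w v → v ∈ X)
    (hanc : ∀ v ∈ X, ∀ w, w ≠ r → IsAncestor T r w v → w ∈ X) {c A : ℕ}
    (hdepth : ∀ v ∈ X, T.dist r v ≤ c + 1) (hex : ∀ j, 1 ≤ j → j ≤ c + 1 → ∃ v ∈ X, T.dist r v = j)
    (hX : #X = A + c) (hn : 6 * A + 3 * (c + 1) + 1 ≤ 2 * Fintype.card V) :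
    #{v ∈ X | T.dist r v = c + 1} ≤ A ∧
    (Fintype.card V : ℚ) * ∑ v ∈ X, (T.dist r v : ℚ) - ∑ w ∈ X, (descCard T r w : ℚ) ^ 2 ≤
      halfBroom (Fintype.card V) (c + 1 : ℕ) A + ((A : ℚ) - #{v ∈ X | T.dist r v = c + 1})
        * (((A : ℚ) + 1) ^ 2 / 2 + 1 - Fintype.card V) := by
  have hpos : ∀ v ∈ X, 1 ≤ T.dist r v := fun v hv =>
    hT.connected.pos_dist_of_ne (by rintro rfl; exact hrX hv)
  -- Counting levels from the bottom turns partial sums of level sizes into the numbers of vertices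
  -- at or below a given depth.
  set lev : ℕ → Finset V := fun i => {v ∈ X | T.dist r v = c + 1 - i} with hlev
  have hcum : ∀ i ≤ c, ∑ j ∈ range (i + 1), #(lev j) = #{v ∈ X | c + 1 - i ≤ T.dist r v} := by
    intro i hi
    rw [card_eq_sum_card_fiberwise (f := fun v => c + 1 - T.dist r v) (t := range (i + 1))]
    · refine sum_congr rfl fun j hj => ?_
      rw [mem_range] at hj
      rw [filter_filter]
      refine congrArg card (filter_congr fun v hv => ?_)
      have := hdepth v hv
      omega
    · intro v hv
      simp only [coe_filter, Set.mem_ofPred_eq] at hv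
      simp only [coe_range, Set.mem_Iio]
      omega
  have hmain := sum_level_le (Fintype.card V) (fun i => #(lev i))
    (fun i => ∑ w ∈ lev i, descCard T r w ^ 2) c ?_ ?_ A ?_ hn
  · refine ⟨hmain.1, ?_⟩
    have hsq : ∑ w ∈ X, (descCard T r w : ℚ) ^ 2
        = ∑ i ∈ range (c + 1), ((∑ w ∈ lev i, descCard T r w ^ 2 : ℕ) : ℚ) := by
      rw [← sum_fiberwise_of_maps_to (s := X) (t := range (c + 1))
        (g := fun v => c + 1 - T.dist r v)]
      · refine sum_congr rfl fun j hj => ?_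
        rw [mem_range] at hj
        push_cast
        refine sum_congr (filter_congr fun v hv => ?_) fun _ _ => rfl
        have := hdepth v hv
        have := hpos v hv
        omega
      · intro v hv
        have := hpos v hv
        rw [mem_range]
        omega
    have hdist : ∑ v ∈ X, (T.dist r v : ℚ)
        = ∑ i ∈ range (c + 1), ((∑ j ∈ range (i + 1), #(lev j) : ℕ) : ℚ) := by
      have h1 : ∑ v ∈ X, T.dist r v = ∑ i ∈ range (c + 1), ∑ j ∈ range (i + 1), #(lev j) := by
        rw [sum_congr rfl fun i hi => hcum i (by rw [mem_range] at hi; omega)]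
        simp only [card_filter]
        rw [sum_comm]
        refine sum_congr rfl fun v hv => ?_
        rw [← card_filter]
        have h2 : (range (c + 1)).filter (fun i => c + 1 - i ≤ T.dist r v)
            = Ico (c + 1 - T.dist r v) (c + 1) := by
          ext i
          have := hpos v hv
          simp only [mem_filter, mem_range, mem_Ico]
          omega
        rw [h2, Nat.card_Ico]
        have := hdepth v hv
        omega
      exact_mod_cast h1
    rw [hsq, hdist, mul_sum, ← sum_sub_distrib]
    rw [Nat.cast_succ c]
    exact hmain.2
  · intro i hi
    obtain ⟨v, hv, hvi⟩ := hex (c + 1 - i) (by omega) (by omega)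
    exact card_pos.2 ⟨v, mem_filter.2 ⟨hv, hvi⟩⟩
  · intro i hi
    -- Cauchy–Schwarz on the descendant counts of one level.
    rw [hcum i hi, ← sum_descCard_level hT hdesc hanc (by omega)]
    exact sq_sum_le_card_mul_sum_sq
  · rw [hcum c le_rfl, ← hX, filter_true_of_mem]
    intro v hv
    have := hpos v hv
    omega

end Wiener

/-! ### Double brooms described by places on a path -/

section Profile

variable {V : Type u} {T : SimpleGraph V} {d : ℕ} {pos : V → ℕ}

/-- `pos` places the vertices of `T` on the path `0, …, d`, with adjacent vertices in neighbouring
places and exactly one vertex in every place other than `0` and `d`. -/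
structure IsBroomProfile (T : SimpleGraph V) (d : ℕ) (pos : V → ℕ) : Prop where
  le : ∀ v, pos v ≤ d
  adj : ∀ {u v}, T.Adj u v → pos u = pos v + 1 ∨ pos v = pos u + 1
  surj : ∀ i ≤ d, ∃ v, pos v = i
  inj : ∀ {u v}, pos u = pos v → 0 < pos u → pos u < d → u = v

namespace IsBroomProfile

theorem reverse (h : IsBroomProfile T d pos) : IsBroomProfile T d (fun v => d - pos v) where
  le v := Nat.sub_le _ _
  adj {u v} huv := by
    have := h.adj huv
    have := h.le u
    have := h.le v
    omega
  surj i hi := by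
    obtain ⟨v, hv⟩ := h.surj (d - i) (by omega)
    exact ⟨v, by omega⟩
  inj {u v} h1 h2 h3 := by
    have := h.le u
    have := h.le v
    exact h.inj (by omega) (by omega) (by omega)

theorem exists_adj_crossing (h : IsBroomProfile T d pos) (hT : T.Connected) {i : ℕ} (hi : i < d) :
    ∃ u v, T.Adj u v ∧ pos u = i ∧ pos v = i + 1 := by
  obtain ⟨x, hx⟩ := h.surj 0 (by omega)
  obtain ⟨y, hy⟩ := h.surj d le_rfl
  obtain ⟨p⟩ := hT x y
  obtain ⟨a, -, ha, hb⟩ := p.exists_boundary_dart {v | pos v ≤ i} (by simp [hx]) (by simp [hy, hi])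
  simp only [Set.mem_ofPred_eq] at ha hb
  have := h.adj a.adj
  exact ⟨a.fst, a.snd, a.adj, by omega, by omega⟩

theorem exists_adj (h : IsBroomProfile T d pos) (hT : T.Connected) (hd : 0 < d) (v : V) :
    ∃ w, T.Adj v w := by
  obtain ⟨x, hx⟩ := h.surj 0 (by omega)
  obtain ⟨y, hy⟩ := h.surj d le_rfl
  have : Nontrivial V := ⟨x, y, by rintro rfl; omega⟩
  exact hT.preconnected.exists_adj_of_nontrivial v

theorem adj_of_succ (h : IsBroomProfile T d pos) (hT : T.Connected) (hd : 2 ≤ d) {u v : V}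
    (huv : pos v = pos u + 1) : T.Adj u v := by
  have hv := h.le v
  rcases Nat.eq_zero_or_pos (pos u) with h0 | h0
  · obtain ⟨w, hw⟩ := h.exists_adj hT (by omega) u
    have := h.adj hw
    rwa [h.inj (u := v) (v := w) (by omega) (by omega) (by omega)]
  rcases eq_or_lt_of_le hv with h1 | h1
  · obtain ⟨w, hw⟩ := h.exists_adj hT (by omega) v
    have := h.adj hw
    have := h.le w
    rw [h.inj (u := u) (v := w) (by omega) (by omega) (by omega)]
    exact hw.symm
  · obtain ⟨a, b, hab, ha, hb⟩ := h.exists_adj_crossing hT (i := pos u) (by omega)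
    rwa [h.inj (u := u) (v := a) (by omega) (by omega) (by omega),
      h.inj (u := v) (v := b) (by omega) (by omega) (by omega)]

theorem adj_iff (h : IsBroomProfile T d pos) (hT : T.Connected) (hd : 2 ≤ d) {u v : V} :
    T.Adj u v ↔ pos u = pos v + 1 ∨ pos v = pos u + 1 :=
  ⟨h.adj, fun huv => huv.elim (fun h1 => (h.adj_of_succ hT hd h1).symm) (h.adj_of_succ hT hd)⟩

theorem pos_le_add_dist (h : IsBroomProfile T d pos) (hT : T.Connected) (u v : V) :
    pos v ≤ pos u + T.dist u v := by
  obtain ⟨p, hp⟩ := hT.exists_walk_length_eq_dist u v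
  rw [← hp]
  clear hp
  induction p with
  | nil => simp
  | cons hadj p ih =>
    have := h.adj hadj
    rw [Walk.length_cons]
    omega

theorem two_le_dist (h : IsBroomProfile T d pos) (hT : T.Connected) {u v : V} (huv : u ≠ v)
    (hp : pos u = pos v) : 2 ≤ T.dist u v := by
  refine hT.one_lt_dist_of_ne_of_not_adj huv fun hadj => ?_
  have := h.adj hadj
  omega

variable [Fintype V]

open Classical in
theorem isLeaf_iff (h : IsBroomProfile T d pos) (hT : T.Connected) (hd : 2 ≤ d) (v : V) :
    IsLeaf T v ↔ pos v = 0 ∨ pos v = d := by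
  have hv := h.le v
  unfold IsLeaf
  constructor
  · intro hdeg
    by_contra hcon
    obtain ⟨a, ha⟩ := h.surj (pos v - 1) (by omega)
    obtain ⟨b, hb⟩ := h.surj (pos v + 1) (by omega)
    rw [← card_neighborFinset_eq_degree, card_eq_one] at hdeg
    obtain ⟨w, hw⟩ := hdeg
    have h1 : a ∈ T.neighborFinset v := by
      rw [mem_neighborFinset, h.adj_iff hT hd]
      omega
    have h2 : b ∈ T.neighborFinset v := by
      rw [mem_neighborFinset, h.adj_iff hT hd]
      omega
    rw [hw, mem_singleton] at h1 h2
    rw [h1] at ha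
    rw [h2] at hb
    omega
  · intro hv'
    obtain ⟨w, hw⟩ := h.exists_adj hT (by omega) v
    rw [← card_neighborFinset_eq_degree, card_eq_one]
    refine ⟨w, ?_⟩
    ext a
    rw [mem_neighborFinset, mem_singleton]
    refine ⟨fun ha => ?_, fun ha => ha ▸ hw⟩
    have := h.adj ha
    have := h.adj hw
    have := h.le a
    have := h.le w
    exact h.inj (by omega) (by omega) (by omega)

open Classical in
theorem degree_eq_of_pos_eq_one (h : IsBroomProfile T d pos) (hT : T.Connected) (hd : 3 ≤ d)
    {v : V} (hv : pos v = 1) : T.degree v = #{w | pos w = 0} + 1 := by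
  obtain ⟨b, hb⟩ := h.surj 2 (by omega)
  rw [← card_neighborFinset_eq_degree, ← card_insert_of_notMem (a := b) (by simp [hb])]
  congr 1
  ext w
  rw [mem_neighborFinset, h.adj_iff hT (by omega), mem_insert, mem_filter_univ, hv]
  constructor
  · rintro (h1 | h1)
    · right; omega
    · left; exact h.inj (by omega) (by omega) (by omega)
  · rintro (rfl | h1)
    · right; omega
    · left; omega

open Classical in
theorem isDoubleBroom (h : IsBroomProfile T d pos) (hT : T.IsTree) (hd : 3 ≤ d) :
    IsDoubleBroom T #{v | pos v = 0} #{v | pos v = d} := by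
  obtain ⟨x₀, hx₀⟩ := h.surj 0 (by omega)
  obtain ⟨y₀, hy₀⟩ := h.surj d le_rfl
  obtain ⟨x, hx⟩ := h.surj 1 (by omega)
  obtain ⟨y, hy⟩ := h.surj (d - 1) (by omega)
  refine ⟨hT, card_pos.2 ⟨x₀, by simpa using hx₀⟩, card_pos.2 ⟨y₀, by simpa using hy₀⟩, x, y,
    by rintro rfl; omega, fun v => ?_, h.degree_eq_of_pos_eq_one hT.connected hd hx, ?_⟩
  · unfold IsBroomVertex
    simp only [h.isLeaf_iff hT.connected (by omega : 2 ≤ d),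
      h.adj_iff hT.connected (by omega : 2 ≤ d)]
    constructor
    · rintro ⟨w, h1, h2⟩
      have := h.le v
      rcases h2 with h2 | h2
      · left; exact h.inj (by omega) (by omega) (by omega)
      · right; exact h.inj (by omega) (by omega) (by omega)
    · rintro (rfl | rfl)
      · exact ⟨x₀, by omega, by omega⟩
      · exact ⟨y₀, by omega, by omega⟩
  · rw [h.reverse.degree_eq_of_pos_eq_one hT.connected hd (by omega)]
    congr 2
    ext v
    have := h.le v
    simp only [mem_filter_univ]
    omega

open Classical in
theorem card_pos_le (h : IsBroomProfile T d pos) {i : ℕ} (hi : i < d) :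
    #{v | pos v ≤ i} = #{v | pos v = 0} + i := by
  induction i with
  | zero => simp
  | succ i ih =>
    rw [← add_assoc, ← ih (by omega)]
    obtain ⟨w, hw⟩ := h.surj (i + 1) hi.le
    rw [← card_insert_of_notMem (a := w) (by simp [hw])]
    congr 1
    ext v
    simp only [mem_insert, mem_filter_univ]
    constructor
    · intro hv
      rcases Nat.lt_or_ge i (pos v) with h1 | h1
      · left; exact h.inj (by omega) (by omega) (by omega)
      · right; exact h1
    · rintro (rfl | h1) <;> omega

open Classical in
theorem card_eq (h : IsBroomProfile T d pos) (hd : 1 ≤ d) :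
    Fintype.card V + 1 = #{v | pos v = 0} + #{v | pos v = d} + d := by
  have h1 := h.card_pos_le (i := d - 1) (by omega)
  have h2 := card_filter_add_card_filter_not (s := (univ : Finset V)) (fun v => pos v ≤ d - 1)
  have h3 : ({v | ¬pos v ≤ d - 1} : Finset V) = ({v | pos v = d} : Finset V) := by
    ext v
    have := h.le v
    simp only [mem_filter_univ]
    omega
  rw [h3, h1, card_univ] at h2
  omega

-- The gap between places `i` and `i + 1` separates as many pairs as the product counts, and each
-- contributes one to their distance. Distinct vertices at the same end are at distance at least
-- two. All is doubled because pairs are ordered.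
open Classical in
theorem le_two_mul_wienerIndex (h : IsBroomProfile T d pos) (hT : T.Connected) (hd : 1 ≤ d) :
    2 * ∑ i ∈ range d, #{v | pos v ≤ i} * #{v | i < pos v}
      + 2 * (#{v | pos v = 0} * (#{v | pos v = 0} - 1)
        + #{v | pos v = d} * (#{v | pos v = d} - 1)) ≤ 2 * wienerIndex T := by
  have h1 : ∀ u v : V, #{i ∈ range d | pos u ≤ i ∧ i < pos v} + #{i ∈ range d | pos v ≤ i ∧ i < pos u}
      + 2 * (if u ≠ v ∧ pos u = pos v then 1 else 0) ≤ T.dist u v := by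
    intro u v
    have key : ∀ a b, #{i ∈ range d | a ≤ i ∧ i < b} ≤ b - a := by
      intro a b
      rw [← Nat.card_Ico]
      refine card_le_card fun i hi => ?_
      simp only [mem_filter] at hi
      exact mem_Ico.2 hi.2
    have k1 := key (pos u) (pos v)
    have k2 := key (pos v) (pos u)
    have k3 := h.pos_le_add_dist hT u v
    have k4 := h.pos_le_add_dist hT v u
    rw [dist_comm] at k4
    split_ifs with hc
    · have := h.two_le_dist hT hc.1 hc.2
      omega
    · omega
  have h2 := sum_le_sum fun u (_ : u ∈ univ) => sum_le_sum fun v (_ : v ∈ univ) => h1 u v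
  rw [← two_mul_wienerIndex] at h2
  simp only [sum_add_distrib, ← mul_sum] at h2
  have h3 : ∑ u, ∑ v, #{i ∈ range d | pos u ≤ i ∧ i < pos v}
      = ∑ i ∈ range d, #{v | pos v ≤ i} * #{v | i < pos v} := by
    have : ∀ u v, #{i ∈ range d | pos u ≤ i ∧ i < pos v}
        = ∑ i ∈ range d, (if pos u ≤ i then 1 else 0) * (if i < pos v then 1 else 0) := by
      intro u v
      rw [card_filter]
      refine sum_congr rfl fun i _ => ?_
      split_ifs <;> simp_all
    simp only [this]
    rw [sum_congr rfl fun u _ => sum_comm, sum_comm]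
    refine sum_congr rfl fun i _ => ?_
    rw [← sum_mul_sum, card_filter, card_filter]
  have h4 : ∑ u, ∑ v, #{i ∈ range d | pos v ≤ i ∧ i < pos u}
      = ∑ i ∈ range d, #{v | pos v ≤ i} * #{v | i < pos v} := by
    rw [sum_comm, h3]
  have h5 : #{v | pos v = 0} * (#{v | pos v = 0} - 1) + #{v | pos v = d} * (#{v | pos v = d} - 1)
      ≤ ∑ u, ∑ v, if u ≠ v ∧ pos u = pos v then 1 else 0 := by
    rw [Nat.mul_sub_one, Nat.mul_sub_one, ← offDiag_card, ← offDiag_card,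
      ← Fintype.sum_prod_type' (f := fun u v => if u ≠ v ∧ pos u = pos v then 1 else 0),
      ← card_filter, ← card_union_of_disjoint]
    · refine card_le_card fun x hx => ?_
      simp only [mem_union, mem_offDiag, mem_filter_univ] at hx ⊢
      rcases hx with hx | hx
      · exact ⟨hx.2.2, by omega⟩
      · exact ⟨hx.2.2, by omega⟩
    · rw [Finset.disjoint_left]
      intro x hx hx'
      simp only [mem_offDiag, mem_filter_univ] at hx hx'
      omega
  rw [h3, h4] at h2
  omega

theorem sum_range_broom (d : ℕ) (A m : ℚ) :
    ∑ i ∈ range d, (A + i) * (m - i) = d * A * m + (m - A) * d * (d - 1) / 2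
      - d * (d - 1) * (2 * d - 1) / 6 := by
  induction d with
  | zero => simp
  | succ d ih =>
    rw [sum_range_succ, ih]
    push_cast
    ring

open Classical in
theorem broomIndex_le_wienerIndex (h : IsBroomProfile T d pos) (hT : T.Connected) (hd : 1 ≤ d) :
    broomIndex d (#{v | pos v = 0} : ℕ) (#{v | pos v = d} : ℕ) ≤ wienerIndex T := by
  have h1 := h.le_two_mul_wienerIndex hT hd
  have h2 := h.card_eq hd
  have h3 : ∀ i ∈ range d, #{v | pos v ≤ i} * #{v | i < pos v}
      = (#{v | pos v = 0} + i) * (#{v | pos v = d} + d - 1 - i) := by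
    intro i hi
    rw [mem_range] at hi
    have h4 := h.card_pos_le hi
    have h5 := card_filter_add_card_filter_not (s := (univ : Finset V)) (fun v => pos v ≤ i)
    simp only [not_le, card_univ] at h5
    rw [h4] at h5 ⊢
    congr 1
    omega
  rw [sum_congr rfl h3] at h1
  obtain ⟨x, hx⟩ := h.surj 0 (by omega)
  obtain ⟨y, hy⟩ := h.surj d le_rfl
  have hA : 1 ≤ #{v | pos v = 0} := card_pos.2 ⟨x, by simpa using hx⟩
  have hB : 1 ≤ #{v | pos v = d} := card_pos.2 ⟨y, by simpa using hy⟩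
  set A := #{v | pos v = 0}
  set B := #{v | pos v = d}
  have h6 : ((∑ i ∈ range d, (A + i) * (B + d - 1 - i) : ℕ) : ℚ)
      = ∑ i ∈ range d, ((A : ℚ) + i) * (((B : ℚ) + d - 1) - i) := by
    rw [Nat.cast_sum]
    refine sum_congr rfl fun i hi => ?_
    rw [mem_range] at hi
    rw [Nat.cast_mul, Nat.cast_sub (by omega), Nat.cast_sub (by omega)]
    push_cast
    ring
  rw [sum_range_broom] at h6
  have h7 : (∑ i ∈ range d, (A + i) * (B + d - 1 - i)) + (A * (A - 1) + B * (B - 1))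
      ≤ wienerIndex T := by omega
  have h8 : ((∑ i ∈ range d, (A + i) * (B + d - 1 - i) : ℕ) : ℚ)
      + (A * (A - 1) + B * (B - 1)) ≤ wienerIndex T := by
    have := (Nat.cast_le (α := ℚ)).2 h7
    rw [Nat.cast_add, Nat.cast_add, Nat.cast_mul A, Nat.cast_mul B, Nat.cast_sub hA,
      Nat.cast_sub hB] at this
    exact_mod_cast this
  rw [h6] at h8
  refine le_trans (le_of_eq ?_) h8
  unfold broomIndex
  ring

end IsBroomProfile
end Profile

/-! ### Existence of double brooms -/

section Construction

variable {V : Type u} {d : ℕ} {pos : V → ℕ}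

/-- The graph joining vertices in neighbouring places. -/
def placeGraph (pos : V → ℕ) : SimpleGraph V where
  Adj u v := pos u = pos v + 1 ∨ pos v = pos u + 1
  symm := ⟨fun _ _ h => h.symm⟩
  loopless := ⟨fun _ h => by omega⟩

theorem placeGraph_isBroomProfile (hle : ∀ v, pos v ≤ d) (hsurj : ∀ i ≤ d, ∃ v, pos v = i)
    (hinj : ∀ u v, pos u = pos v → 0 < pos u → pos u < d → u = v) :
    IsBroomProfile (placeGraph pos) d pos :=
  ⟨hle, fun h => h, hsurj, fun {u v} => hinj u v⟩

theorem exists_walk_placeGraph (hsurj : ∀ i ≤ d, ∃ v, pos v = i) (k : ℕ) {u v : V}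
    (hv : pos v = pos u + (k + 1)) (hd : pos v ≤ d) :
    ∃ p : (placeGraph pos).Walk u v, p.length = k + 1 := by
  induction k generalizing v with
  | zero =>
    have h : (placeGraph pos).Adj u v := Or.inr hv
    exact ⟨h.toWalk, by simp⟩
  | succ k ih =>
    obtain ⟨w, hw⟩ := hsurj (pos u + (k + 1)) (by omega)
    obtain ⟨p, hp⟩ := ih hw (by omega)
    have h : (placeGraph pos).Adj w v := Or.inr (by omega)
    exact ⟨p.concat h, by rw [Walk.length_concat, hp]⟩

theorem exists_walk_placeGraph_le (hle : ∀ v, pos v ≤ d) (hsurj : ∀ i ≤ d, ∃ v, pos v = i)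
    (hd : 2 ≤ d) (hinj : ∀ u v, pos u = pos v → 0 < pos u → pos u < d → u = v) (u v : V) :
    ∃ p : (placeGraph pos).Walk u v, p.length ≤ d := by
  have hu := hle u
  have hv := hle v
  rcases lt_trichotomy (pos u) (pos v) with h | h | h
  · obtain ⟨p, hp⟩ := exists_walk_placeGraph hsurj (pos v - pos u - 1) (u := u) (v := v)
      (by omega) hv
    exact ⟨p, by omega⟩
  · by_cases huv : u = v
    · subst huv
      exact ⟨Walk.nil, by simp⟩
    · have h0 : pos u = 0 ∨ pos u = d := by
        by_contra hcon
        exact huv (hinj u v h (by omega) (by omega))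
      obtain ⟨w, hw⟩ := hsurj (if pos u = 0 then 1 else d - 1) (by split_ifs <;> omega)
      have h1 : (placeGraph pos).Adj u w := by
        unfold placeGraph
        split_ifs at hw <;> simp only <;> omega
      have h2 : (placeGraph pos).Adj w v := by
        unfold placeGraph
        split_ifs at hw <;> simp only <;> omega
      exact ⟨Walk.cons h1 (Walk.cons h2 Walk.nil), by simpa using hd⟩
  · obtain ⟨p, hp⟩ := exists_walk_placeGraph hsurj (pos u - pos v - 1) (u := v) (v := u)
      (by omega) hu
    exact ⟨p.reverse, by rw [Walk.length_reverse]; omega⟩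

theorem placeGraph_connected (hle : ∀ v, pos v ≤ d) (hsurj : ∀ i ≤ d, ∃ v, pos v = i)
    (hd : 2 ≤ d) (hinj : ∀ u v, pos u = pos v → 0 < pos u → pos u < d → u = v) :
    (placeGraph pos).Connected where
  preconnected u v := (exists_walk_placeGraph_le hle hsurj hd hinj u v).choose.reachable
  nonempty := ⟨(hsurj 0 (by omega)).choose⟩

theorem placeGraph_diam [Fintype V] (hle : ∀ v, pos v ≤ d) (hsurj : ∀ i ≤ d, ∃ v, pos v = i)
    (hd : 2 ≤ d) (hinj : ∀ u v, pos u = pos v → 0 < pos u → pos u < d → u = v) :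
    (placeGraph pos).diam = d := by
  have hc := placeGraph_connected hle hsurj hd hinj
  have := hc.nonempty
  apply le_antisymm
  · obtain ⟨u, v, huv⟩ := (placeGraph pos).exists_dist_eq_diam
    obtain ⟨p, hp⟩ := exists_walk_placeGraph_le hle hsurj hd hinj u v
    rw [← huv]
    exact (dist_le p).trans hp
  · obtain ⟨x, hx⟩ := hsurj 0 (by omega)
    obtain ⟨y, hy⟩ := hsurj d le_rfl
    have h1 := (placeGraph_isBroomProfile hle hsurj hinj).pos_le_add_dist hc x y
    have h2 := dist_le_diam (connected_iff_ediam_ne_top.1 hc) (u := x) (v := y)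
    omega

theorem placeGraph_isTree [Fintype V] (hle : ∀ v, pos v ≤ d) (hsurj : ∀ i ≤ d, ∃ v, pos v = i)
    (hd : 2 ≤ d) (hinj : ∀ u v, pos u = pos v → 0 < pos u → pos u < d → u = v) :
    (placeGraph pos).IsTree := by
  have hc := placeGraph_connected hle hsurj hd hinj
  rw [isTree_iff_connected_and_card]
  refine ⟨hc, le_antisymm ?_ hc.card_vert_le_card_edgeSet_add_one⟩
  obtain ⟨x, hx⟩ := hsurj 1 (by omega)
  have := hc.nonempty
  choose! f hf using hsurj
  -- Orient all edges towards the vertex `x` in place `1`: each edge is then `s(v, par v)` for some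
  -- `v ≠ x`, which leaves at most `|V| - 1` edges. The value at `x` itself is irrelevant.
  let par : V → V := fun v => f (if pos v = 0 then 1 else pos v - 1)
  have hpar : ∀ v, pos (par v) = if pos v = 0 then 1 else pos v - 1 := by
    intro v
    have := hle v
    exact hf _ (by split_ifs <;> omega)
  have hsub : (placeGraph pos).edgeSet ⊆ (fun v => s(v, par v)) '' {v | v ≠ x} := by
    intro e he
    induction e with
    | _ u v =>
      have key : ∀ u v, pos v = pos u + 1 → s(u, v) ∈ (fun v => s(v, par v)) '' {v | v ≠ x} := by
        intro u v huv
        have := hle v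
        by_cases h0 : pos u = 0
        · refine ⟨u, by rintro rfl; omega, ?_⟩
          have h1 := hpar u
          rw [if_pos h0] at h1
          simp only
          rw [hinj (par u) v (by omega) (by omega) (by omega)]
        · refine ⟨v, by rintro rfl; omega, ?_⟩
          have h1 := hpar v
          rw [if_neg (by omega)] at h1
          simp only
          rw [hinj (par v) u (by omega) (by omega) (by omega), Sym2.eq_swap]
      rcases he with h | h
      · rw [Sym2.eq_swap]
        exact key v u h
      · exact key u v h
  have h1 := Set.ncard_le_ncard hsub (Set.toFinite _)
  have h2 := Set.ncard_image_le (f := fun v => s(v, par v)) (Set.toFinite {v | v ≠ x})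
  have h3 : Set.ncard {v | v ≠ x} + 1 = Nat.card V := by
    have := Set.ncard_add_ncard_compl ({x} : Set V)
    rw [Set.ncard_singleton] at this
    rw [← this, add_comm]
    rfl
  rw [← Nat.card_coe_set_eq] at h1
  omega

open Classical in
/-- Double brooms exist in every diameter and with any numbers of leaves. -/
theorem exists_isBroomProfile [Fintype V] {a b : ℕ} (hd : 2 ≤ d) (ha : 1 ≤ a) (hb : 1 ≤ b)
    (hV : Fintype.card V + 1 = a + b + d) :
    ∃ (T : SimpleGraph V) (pos : V → ℕ), T.IsTree ∧ T.diam = d ∧ IsBroomProfile T d pos ∧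
      #{v | pos v = 0} = a ∧ #{v | pos v = d} = b := by
  let e := Fintype.equivFin V
  -- Truncated subtraction puts the first `a` indices in place `0`, and the minimum puts the last
  -- `b` in place `d`.
  let pos : V → ℕ := fun v => min d ((e v : ℕ) + 1 - a)
  have hlt : ∀ v, (e v : ℕ) < Fintype.card V := fun v => (e v).2
  have hle : ∀ v, pos v ≤ d := fun v => min_le_left _ _
  have hsurj : ∀ i ≤ d, ∃ v, pos v = i := by
    intro i hi
    refine ⟨e.symm ⟨i + a - 1, by omega⟩, ?_⟩
    simp only [pos, Equiv.apply_symm_apply]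
    omega
  have hinj : ∀ u v, pos u = pos v → 0 < pos u → pos u < d → u = v := by
    intro u v h1 h2 h3
    apply e.injective
    apply Fin.ext
    simp only [pos] at h1 h2 h3
    omega
  have hprof := placeGraph_isBroomProfile hle hsurj hinj
  have hA : #{v | pos v = 0} = a := by
    have : #{v | pos v = 0} = #(range a) := by
      refine card_bij (fun v _ => (e v : ℕ)) ?_ ?_ ?_
      · intro v hv
        simp only [mem_filter_univ, pos] at hv
        rw [mem_range]
        omega
      · intro u _ v _ h
        exact e.injective (Fin.ext h)
      · intro i hi
        rw [mem_range] at hi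
        refine ⟨e.symm ⟨i, by omega⟩, ?_, by simp⟩
        simp only [mem_filter_univ, pos, Equiv.apply_symm_apply]
        omega
    rw [this, card_range]
  refine ⟨placeGraph pos, pos, placeGraph_isTree hle hsurj hd hinj,
    placeGraph_diam hle hsurj hd hinj, hprof, hA, ?_⟩
  have := hprof.card_eq (by omega)
  omega

end Construction

/-! ### Splitting a tree at an edge of a longest path -/

section Split

variable {V : Type u} {T : SimpleGraph V} {x y r z : V} {c e : ℕ}

/-- The tree `T` has diameter `c + e`, attained by `x` and `y`; the edge `r z` is the one on the
path from `x` to `y` whose first end `r` has distance `c` from `x`. -/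
structure IsSplit (T : SimpleGraph V) (x y r z : V) (c e : ℕ) : Prop where
  isTree : T.IsTree
  adj : T.Adj r z
  dist_le : ∀ u v, T.dist u v ≤ c + e
  dist_left : T.dist x r = c
  dist_left' : T.dist x z = c + 1
  dist_right : T.dist r y = e
  dist_right' : T.dist z y + 1 = e

open Classical in
/-- The place of a vertex between the two ends: its depth below the root `r` is measured from `c`,
upwards on the side of `z` and downwards on the other side. -/
noncomputable def place (T : SimpleGraph V) (r z : V) (c : ℕ) (v : V) : ℕ :=
  if IsAncestor T r z v then c + T.dist r v else c - T.dist r v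

theorem exists_isSplit [Fintype V] (hT : T.IsTree) (hd : T.diam = c + e) (he : 1 ≤ e) :
    ∃ x y r z, IsSplit T x y r z c e := by
  have := hT.connected.nonempty
  obtain ⟨x, y, hxy⟩ := T.exists_dist_eq_diam
  rw [hd] at hxy
  obtain ⟨r, hr, hry⟩ := exists_isAncestor hT.connected x y (j := c) (by omega)
  obtain ⟨z, hz, hzy⟩ := exists_isAncestor hT.connected x y (j := c + 1) (by omega)
  have hrz := hry.of_dist_le hT hzy (by omega)
  refine ⟨x, y, r, z, hT, (adj_iff_isAncestor hT).2 (Or.inl ⟨hrz, by omega⟩), fun u v => ?_, hr, hz,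
    ?_, ?_⟩
  · rw [← hd]
    exact dist_le_diam (connected_iff_ediam_ne_top.1 hT.connected)
  · unfold IsAncestor at hry
    omega
  · unfold IsAncestor at hzy
    omega

namespace IsSplit

theorem dist_root (h : IsSplit T x y r z c e) : T.dist r z = 1 := dist_eq_one_iff_adj.2 h.adj

theorem dist_of_not_isAncestor (h : IsSplit T x y r z c e) {v : V} (hv : ¬IsAncestor T r z v) :
    T.dist v z = T.dist v r + 1 := by
  rcases h.isTree.dist_eq_dist_add_one_of_adj v h.adj with h1 | h1
  · refine absurd ?_ hv
    unfold IsAncestor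
    rw [h.dist_root, dist_comm (u := r), dist_comm (u := z)]
    omega
  · exact h1

theorem dist_of_isAncestor (h : IsSplit T x y r z c e) {v : V} (hv : IsAncestor T r z v) :
    T.dist v r = T.dist v z + 1 := by
  unfold IsAncestor at hv
  rw [h.dist_root, dist_comm (u := r), dist_comm (u := z)] at hv
  omega

/-- The path from `v` to `y` crosses the edge `r z`, so its length is the depth of `v` plus `e`,
which the diameter bounds by `c + e`. -/
theorem depth_le_left (h : IsSplit T x y r z c e) {v : V} (hv : ¬IsAncestor T r z v) :
    T.dist r v ≤ c := by
  have h1 := dist_eq_of_adj_between h.isTree (u := v) (v := y) h.adj (h.dist_of_not_isAncestor hv)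
    (by rw [dist_comm, h.dist_right, dist_comm, h.dist_right'])
  have h2 := h.dist_le v y
  have h3 := h.dist_right'
  rw [dist_comm (u := y)] at h1
  rw [dist_comm (u := r)]
  omega

theorem depth_le_right (h : IsSplit T x y r z c e) {v : V} (hv : IsAncestor T r z v) :
    T.dist r v ≤ e := by
  have h0 := h.dist_of_isAncestor hv
  have h1 := dist_eq_of_adj_between h.isTree (u := x) (v := v) h.adj
    (by rw [h.dist_left, h.dist_left']) h0
  have h2 := h.dist_le x v
  have h3 := h.dist_left
  rw [dist_comm (u := r)]
  omega

theorem isAncestor_right (h : IsSplit T x y r z c e) : IsAncestor T r z y := by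
  have h1 := h.dist_right
  have h2 := h.dist_right'
  have h3 := h.dist_root
  unfold IsAncestor
  omega

theorem not_isAncestor_left (h : IsSplit T x y r z c e) : ¬IsAncestor T r z x := by
  intro hx
  have h1 := h.dist_of_isAncestor hx
  have h2 := h.dist_left
  have h3 := h.dist_left'
  omega

theorem not_isAncestor_root (h : IsSplit T x y r z c e) : ¬IsAncestor T r z r := by
  intro hr
  have h1 := hr.dist_le
  rw [dist_self, h.dist_root] at h1
  omega

theorem isAncestor_iff (h : IsSplit T x y r z c e) {w v : V} (hw : w ≠ r)
    (hwv : IsAncestor T r w v) : IsAncestor T r z w ↔ IsAncestor T r z v := by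
  refine ⟨fun hz => hz.trans h.isTree.connected hwv, fun hz => hz.of_dist_le h.isTree hwv ?_⟩
  rw [h.dist_root]
  exact h.isTree.connected.pos_dist_of_ne hw.symm

theorem place_le (h : IsSplit T x y r z c e) (v : V) : place T r z c v ≤ c + e := by
  unfold place
  split_ifs with hv
  · have := h.depth_le_right hv
    omega
  · omega

theorem place_adj (h : IsSplit T x y r z c e) (hc : 1 ≤ c) {u v : V} (huv : T.Adj u v) :
    place T r z c u = place T r z c v + 1 ∨ place T r z c v = place T r z c u + 1 := by
  have key : ∀ u v, IsAncestor T r u v → T.dist r v = T.dist r u + 1 →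
      place T r z c u = place T r z c v + 1 ∨ place T r z c v = place T r z c u + 1 := by
    intro u v h1 h2
    by_cases hu : u = r
    · subst hu
      rw [dist_self] at h2
      unfold place
      rw [if_neg h.not_isAncestor_root, dist_self, h2]
      split_ifs <;> omega
    · have h3 := h.isAncestor_iff hu h1
      unfold place
      by_cases hv : IsAncestor T r z v
      · rw [if_pos hv, if_pos (h3.2 hv)]
        omega
      · rw [if_neg hv, if_neg (fun hu' => hv (h3.1 hu'))]
        have := h.depth_le_left hv
        omega
  rcases (adj_iff_isAncestor h.isTree (r := r)).1 huv with ⟨h1, h2⟩ | ⟨h1, h2⟩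
  · exact key u v h1 h2
  · exact (key v u h1 h2).symm

theorem exists_left (h : IsSplit T x y r z c e) {j : ℕ} (hj1 : 1 ≤ j) (hj : j ≤ c) :
    ∃ v, v ≠ r ∧ ¬IsAncestor T r z v ∧ T.dist r v = j ∧ IsAncestor T r v x := by
  have h1 := h.dist_left
  rw [dist_comm] at h1
  obtain ⟨v, hv, hvx⟩ := exists_isAncestor h.isTree.connected r x (j := j) (by omega)
  have hr : v ≠ r := by
    rintro rfl
    rw [dist_self] at hv
    omega
  exact ⟨v, hr, fun hz => h.not_isAncestor_left ((h.isAncestor_iff hr hvx).1 hz), hv, hvx⟩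

theorem exists_right (h : IsSplit T x y r z c e) {j : ℕ} (hj1 : 1 ≤ j) (hj : j ≤ e) :
    ∃ v, IsAncestor T r z v ∧ T.dist r v = j ∧ IsAncestor T r v y := by
  have h1 := h.dist_right
  obtain ⟨v, hv, hvy⟩ := exists_isAncestor h.isTree.connected r y (j := j) (by omega)
  have hr : v ≠ r := by
    rintro rfl
    rw [dist_self] at hv
    omega
  exact ⟨v, (h.isAncestor_iff hr hvy).2 h.isAncestor_right, hv, hvy⟩

theorem place_surj (h : IsSplit T x y r z c e) {i : ℕ} (hi : i ≤ c + e) :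
    ∃ v, place T r z c v = i := by
  rcases lt_trichotomy i c with hlt | rfl | hgt
  · obtain ⟨v, -, h1, h2, -⟩ := h.exists_left (j := c - i) (by omega) (by omega)
    refine ⟨v, ?_⟩
    unfold place
    rw [if_neg h1]
    omega
  · refine ⟨r, ?_⟩
    unfold place
    rw [if_neg h.not_isAncestor_root, dist_self]
    rfl
  · obtain ⟨v, h1, h2, -⟩ := h.exists_right (j := i - c) (by omega) (by omega)
    refine ⟨v, ?_⟩
    unfold place
    rw [if_pos h1]
    omega

/-- The places form a broom profile as soon as every side has only one vertex of each depth other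
than the largest one. -/
theorem isBroomProfile (h : IsSplit T x y r z c e) (hc : 1 ≤ c)
    (hl : ∀ u v, ¬IsAncestor T r z u → ¬IsAncestor T r z v → T.dist r u = T.dist r v →
      T.dist r u < c → u = v)
    (hr : ∀ u v, IsAncestor T r z u → IsAncestor T r z v → T.dist r u = T.dist r v →
      T.dist r u < e → u = v) :
    IsBroomProfile T (c + e) (place T r z c) where
  le := h.place_le
  adj := h.place_adj hc
  surj _ hi := h.place_surj hi
  inj {u v} h1 h2 h3 := by
    unfold place at h1 h2 h3
    have hpos : ∀ w, IsAncestor T r z w → 1 ≤ T.dist r w := fun w hw => by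
      have := hw.dist_le
      rwa [h.dist_root] at this
    by_cases hu : IsAncestor T r z u <;> by_cases hv : IsAncestor T r z v
    · rw [if_pos hu] at h1 h3
      rw [if_pos hv] at h1
      exact hr u v hu hv (by omega) (by omega)
    · rw [if_pos hu, if_neg hv] at h1
      have := hpos u hu
      omega
    · rw [if_neg hu, if_pos hv] at h1
      have := hpos v hv
      omega
    · rw [if_neg hu] at h1 h2
      rw [if_neg hv] at h1
      have := h.depth_le_left hu
      have := h.depth_le_left hv
      exact hl u v hu hv (by omega) (by omega)

section Broom

variable [Fintype V]

open Classical in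
theorem isLeaf_of_forall_depth_le (hT : T.IsTree) {v : V} (hv : v ≠ r)
    (hmax : ∀ w, IsAncestor T r v w → T.dist r w ≤ T.dist r v) : IsLeaf T v := by
  have hpos := hT.connected.pos_dist_of_ne hv.symm
  obtain ⟨p, hp, hpv⟩ := exists_isAncestor hT.connected r v (j := T.dist r v - 1) (by omega)
  unfold IsLeaf
  rw [← card_neighborFinset_eq_degree, card_eq_one]
  refine ⟨p, ?_⟩
  ext w
  rw [mem_neighborFinset, mem_singleton, adj_iff_isAncestor hT (r := r)]
  constructor
  · rintro (⟨h1, h2⟩ | ⟨h1, h2⟩)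
    · have := hmax w h1
      omega
    · exact h1.eq_of_dist_eq hT hpv (by omega)
  · rintro rfl
    exact Or.inr ⟨hpv, by omega⟩

theorem isBroomVertex_of_parent (hT : T.IsTree) {p v : V} (hv : v ≠ r) (hpv : IsAncestor T r p v)
    (hp : T.dist r v = T.dist r p + 1)
    (hmax : ∀ w, IsAncestor T r v w → T.dist r w ≤ T.dist r v) : IsBroomVertex T p :=
  ⟨v, (adj_iff_isAncestor hT).2 (Or.inl ⟨hpv, hp⟩), isLeaf_of_forall_depth_le hT hv hmax⟩

/-- In a double broom every vertex has a place at an end or lies on the path between the ends. -/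
theorem isAncestor_end_of_isDoubleBroom (h : IsSplit T x y r z c e) (hc : 2 ≤ c) (he : 2 ≤ e)
    {a b : ℕ} (hT : IsDoubleBroom T a b) (v : V) :
    IsAncestor T r v x ∨ IsAncestor T r v y ∨ (¬IsAncestor T r z v ∧ T.dist r v = c) ∨
      (IsAncestor T r z v ∧ T.dist r v = e) := by
  classical
  by_cases hvr : v = r
  · subst hvr
    left
    simp [IsAncestor]
  obtain ⟨-, -, -, s, t, -, hst, -, -⟩ := hT
  obtain ⟨p, hpr, hpz, hp, hpx⟩ := h.exists_left (j := c - 1) (by omega) (by omega)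
  obtain ⟨q, hqz, hq, hqy⟩ := h.exists_right (j := e - 1) (by omega) (by omega)
  have hxr : x ≠ r := by
    rintro rfl
    have := h.dist_left
    rw [dist_self] at this
    omega
  have hyr : y ≠ r := by
    rintro rfl
    have := h.dist_right
    rw [dist_self] at this
    omega
  have hqr : q ≠ r := by
    rintro rfl
    exact h.not_isAncestor_root hqz
  have hdx : T.dist r x = c := by rw [dist_comm, h.dist_left]
  have hpb : IsBroomVertex T p := isBroomVertex_of_parent h.isTree hxr hpx (by omega) fun w hw => by
    rw [hdx]
    exact h.depth_le_left fun hz => h.not_isAncestor_left ((h.isAncestor_iff hxr hw).2 hz)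
  have hqb : IsBroomVertex T q := isBroomVertex_of_parent h.isTree hyr hqy
      (by rw [h.dist_right]; omega) fun w hw => by
    rw [h.dist_right]
    exact h.depth_le_right ((h.isAncestor_iff hyr hw).1 h.isAncestor_right)
  have hpq : p ≠ q := by
    rintro rfl
    exact hpz hqz
  -- A deepest descendant `w` of `v` is a leaf, so its parent is a broom vertex and must be one of
  -- the parents `p`, `q` of `x`, `y`. Either `v = w` has full depth, or `v` is an ancestor of `p`
  -- or `q`.
  obtain ⟨w, hw, hmax⟩ := exists_max_image ({w | IsAncestor T r v w} : Finset V) (T.dist r)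
    ⟨v, by rw [mem_filter_univ]; exact IsAncestor.refl T r v⟩
  simp only [mem_filter_univ] at hw hmax
  have hvpos := h.isTree.connected.pos_dist_of_ne (Ne.symm hvr)
  have hwv := hw.dist_le
  have hwr : w ≠ r := by
    rintro rfl
    rw [dist_self] at hwv
    omega
  obtain ⟨m, hm, hmw⟩ := exists_isAncestor h.isTree.connected r w (j := T.dist r w - 1) (by omega)
  have hmb : IsBroomVertex T m := isBroomVertex_of_parent h.isTree hwr hmw (by omega)
    fun w' hw' => hmax w' (hw.trans h.isTree.connected hw')
  have hmpq : m = p ∨ m = q := by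
    rw [hst] at hpb hqb hmb
    grind
  by_cases hvw : v = w
  · subst hvw
    right; right
    rcases hmpq with rfl | rfl
    · left
      exact ⟨fun hz => hpz ((h.isAncestor_iff hpr hmw).2 hz), by omega⟩
    · right
      exact ⟨(h.isAncestor_iff hqr hmw).1 hqz, by omega⟩
  · have hlt : T.dist r v < T.dist r w := by
      by_contra hcon
      exact hvw (hw.eq_of_dist_le h.isTree.connected (by omega))
    have hvm := hw.of_dist_le h.isTree hmw (by omega)
    rcases hmpq with rfl | rfl
    · left
      exact hvm.trans h.isTree.connected hpx
    · right; left
      exact hvm.trans h.isTree.connected hqy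

theorem isBroomProfile_of_isDoubleBroom (h : IsSplit T x y r z c e) (hc : 2 ≤ c) (he : 2 ≤ e)
    {a b : ℕ} (hT : IsDoubleBroom T a b) : IsBroomProfile T (c + e) (place T r z c) := by
  have key := h.isAncestor_end_of_isDoubleBroom hc he hT
  have hleft : ∀ u, u ≠ r → ¬IsAncestor T r z u → T.dist r u < c → IsAncestor T r u x := by
    intro u hur hu hlt
    rcases key u with h1 | h1 | h1 | h1
    · exact h1
    · exact absurd ((h.isAncestor_iff hur h1).2 h.isAncestor_right) hu
    · omega
    · exact absurd h1.1 hu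
  have hright : ∀ u, IsAncestor T r z u → T.dist r u < e → IsAncestor T r u y := by
    intro u hu hlt
    rcases key u with h1 | h1 | h1 | h1
    · refine absurd ((h.isAncestor_iff ?_ h1).1 hu) h.not_isAncestor_left
      rintro rfl
      exact h.not_isAncestor_root hu
    · exact h1
    · exact absurd hu h1.1
    · omega
  refine h.isBroomProfile (by omega) (fun u v hu hv huv hlt => ?_) fun u v hu hv huv hlt =>
    (hright u hu hlt).eq_of_dist_eq h.isTree (hright v hv (by omega)) huv
  have hroot : ∀ w, T.dist r w = 0 → w = r := fun w hw =>
    (h.isTree.connected.dist_eq_zero_iff.1 hw).symm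
  by_cases h0 : T.dist r u = 0
  · rw [hroot u h0, hroot v (by omega)]
  · have hur : u ≠ r := by
      rintro rfl
      exact h0 dist_self
    have hvr : v ≠ r := by
      rintro rfl
      rw [dist_self] at huv
      omega
    exact (hleft u hur hu hlt).eq_of_dist_eq h.isTree (hleft v hvr hv (by omega)) huv

end Broom
end IsSplit
end Split

/-- The `c` levels below the value `c + 1` are nonempty; if they have only `c` elements in all, each
has exactly one. This is how zero surplus forces the shape of a broom. -/
theorem injOn_of_card_levels {α : Type*} {X : Finset α} {f : α → ℕ} {c : ℕ}
    (hf : ∀ v ∈ X, 1 ≤ f v ∧ f v ≤ c + 1) (hex : ∀ j, 1 ≤ j → j ≤ c → ∃ v ∈ X, f v = j) :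
    #{v ∈ X | f v = c + 1} + c ≤ #X ∧ (#X ≤ #{v ∈ X | f v = c + 1} + c →
      ∀ u ∈ X, ∀ v ∈ X, f u = f v → f u < c + 1 → u = v) := by
  classical
  have h1 := card_filter_add_card_filter_not (s := X) (fun v => f v = c + 1)
  have h2 : ({v ∈ X | ¬f v = c + 1}).image f = Icc 1 c := by
    ext j
    simp only [mem_image, mem_filter, mem_Icc]
    constructor
    · rintro ⟨v, hv, rfl⟩
      have := hf v hv.1
      omega
    · rintro ⟨hj1, hj⟩
      obtain ⟨v, hv, hvj⟩ := hex j hj1 hj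
      exact ⟨v, ⟨hv, by omega⟩, hvj⟩
  have h3 : #(({v ∈ X | ¬f v = c + 1}).image f) = c := by
    rw [h2, Nat.card_Icc, Nat.add_sub_cancel]
  have h4 : c ≤ #{v ∈ X | ¬f v = c + 1} :=
    h3.ge.trans card_image_le
  refine ⟨by omega, fun h5 u hu v hv huv hlt => ?_⟩
  have h6 : Set.InjOn f ({v ∈ X | ¬f v = c + 1} : Finset α) :=
    card_image_iff.1 (by omega)
  exact h6 (by simp [hu]; omega) (by simp [hv]; omega) huv

/-! ### The upper bound in terms of leaves and surplus -/

section Bound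

variable {V : Type u} [Fintype V] {T : SimpleGraph V} {x y r z : V} {c e : ℕ}

namespace IsSplit

open Classical in
theorem wienerIndex_le (h : IsSplit T x y r z (c + 1) (e + 1))
    (hc : 6 * Fintype.card V + 3 * (c + 1) + 7 ≤ 2 * Fintype.card V + 6 * (c + 1 + (e + 1)))
    (he : 6 * Fintype.card V + 3 * (e + 1) + 7 ≤ 2 * Fintype.card V + 6 * (c + 1 + (e + 1))) :
    ∃ A B P Q : ℕ, Fintype.card V + 1 = A + B + (c + 1 + (e + 1)) ∧ P + 1 ≤ A ∧ Q + 1 ≤ B ∧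
      (wienerIndex T : ℚ) ≤ broomIndex (c + 1 + (e + 1) : ℕ) A B
        + P * (((A : ℚ) + 1) ^ 2 / 2 + 1 - Fintype.card V)
        + Q * (((B : ℚ) + 1) ^ 2 / 2 + 1 - Fintype.card V) ∧
      (P = 0 → Q = 0 → IsBroomProfile T (c + 1 + (e + 1)) (place T r z (c + 1)) ∧
        #{v | place T r z (c + 1) v = 0} = A ∧
        #{v | place T r z (c + 1) v = c + 1 + (e + 1)} = B) := by
  have hT := h.isTree
  set L : Finset V := {v | v ≠ r ∧ ¬IsAncestor T r z v} with hL
  set R : Finset V := {v | IsAncestor T r z v} with hR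
  have memL : ∀ v, v ∈ L ↔ v ≠ r ∧ ¬IsAncestor T r z v := fun v => by rw [hL, mem_filter_univ]
  have memR : ∀ v, v ∈ R ↔ IsAncestor T r z v := fun v => by rw [hR, mem_filter_univ]
  have hrL : r ∉ L := by simp [memL]
  have hrR : r ∉ R := by simp [memR, h.not_isAncestor_root]
  have hdisj : Disjoint L R := by
    rw [Finset.disjoint_left]
    intro v hv hv'
    exact ((memL v).1 hv).2 ((memR v).1 hv')
  have hunion : ({w | w ≠ r} : Finset V) = L ∪ R := by
    ext v
    rw [mem_filter_univ, mem_union, memL, memR]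
    constructor
    · intro hv
      tauto
    · rintro (hv | hv)
      · exact hv.1
      · rintro rfl
        exact h.not_isAncestor_root hv
  have hcard : Fintype.card V = #L + #R + 1 := by
    rw [← card_union_of_disjoint hdisj, ← hunion, filter_ne', card_erase_of_mem (mem_univ r),
      card_univ]
    have := Fintype.card_pos_iff.2 ⟨r⟩
    omega
  have hposn : ∀ v, v ≠ r → 1 ≤ T.dist r v := fun v hv => hT.connected.pos_dist_of_ne hv.symm
  have hdescL : ∀ w ∈ L, ∀ v, IsAncestor T r w v → v ∈ L := by
    intro w hw v hwv
    rw [memL] at hw ⊢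
    refine ⟨?_, fun hv => hw.2 ((h.isAncestor_iff hw.1 hwv).2 hv)⟩
    rintro rfl
    have := hwv.dist_le
    have := hposn w hw.1
    rw [dist_self] at *
    omega
  have hancL : ∀ v ∈ L, ∀ w, w ≠ r → IsAncestor T r w v → w ∈ L := by
    intro v hv w hw hwv
    rw [memL] at hv ⊢
    exact ⟨hw, fun hw' => hv.2 ((h.isAncestor_iff hw hwv).1 hw')⟩
  have hdescR : ∀ w ∈ R, ∀ v, IsAncestor T r w v → v ∈ R := by
    intro w hw v hwv
    rw [memR] at hw ⊢
    exact hw.trans hT.connected hwv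
  have hancR : ∀ v ∈ R, ∀ w, w ≠ r → IsAncestor T r w v → w ∈ R := by
    intro v hv w hw hwv
    rw [memR] at hv ⊢
    exact (h.isAncestor_iff hw hwv).2 hv
  have hdepL : ∀ v ∈ L, T.dist r v ≤ c + 1 := fun v hv => h.depth_le_left ((memL v).1 hv).2
  have hdepR : ∀ v ∈ R, T.dist r v ≤ e + 1 := fun v hv => h.depth_le_right ((memR v).1 hv)
  have hexL : ∀ j, 1 ≤ j → j ≤ c + 1 → ∃ v ∈ L, T.dist r v = j := by
    intro j hj1 hj
    obtain ⟨v, h1, h2, h3, -⟩ := h.exists_left hj1 hj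
    exact ⟨v, (memL v).2 ⟨h1, h2⟩, h3⟩
  have hexR : ∀ j, 1 ≤ j → j ≤ e + 1 → ∃ v ∈ R, T.dist r v = j := by
    intro j hj1 hj
    obtain ⟨v, h1, h2, -⟩ := h.exists_right hj1 hj
    exact ⟨v, (memR v).2 h1, h2⟩
  obtain ⟨hL1, hL2⟩ := injOn_of_card_levels (X := L) (f := T.dist r) (c := c)
    (fun v hv => ⟨hposn v ((memL v).1 hv).1, hdepL v hv⟩) (fun j h1 h2 => hexL j h1 (by omega))
  obtain ⟨hR1, hR2⟩ := injOn_of_card_levels (X := R) (f := T.dist r) (c := e)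
    (fun v hv => ⟨hposn v (by rintro rfl; exact hrR hv), hdepR v hv⟩)
    (fun j h1 h2 => hexR j h1 (by omega))
  have hL0 : 1 ≤ #{v ∈ L | T.dist r v = c + 1} := by
    obtain ⟨v, hv, hvc⟩ := hexL (c + 1) (by omega) le_rfl
    exact card_pos.2 ⟨v, mem_filter.2 ⟨hv, hvc⟩⟩
  have hR0 : 1 ≤ #{v ∈ R | T.dist r v = e + 1} := by
    obtain ⟨v, hv, hvc⟩ := hexR (e + 1) (by omega) le_rfl
    exact card_pos.2 ⟨v, mem_filter.2 ⟨hv, hvc⟩⟩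
  -- `A` is the number of leaves this side would have with one vertex on each of its `c` levels
  -- above the deepest.
  obtain ⟨A, hA⟩ : ∃ A, #L = A + c := ⟨#L - c, by omega⟩
  obtain ⟨B, hB⟩ : ∃ B, #R = B + e := ⟨#R - e, by omega⟩
  obtain ⟨-, hbL⟩ := branch_sum_le hT hrL hdescL hancL hdepL hexL hA (by omega)
  obtain ⟨-, hbR⟩ := branch_sum_le hT hrR hdescR hancR hdepR hexR hB (by omega)
  have hn : Fintype.card V + 1 = A + B + (c + 1 + (e + 1)) := by omega
  refine ⟨A, B, A - #{v ∈ L | T.dist r v = c + 1}, B - #{v ∈ R | T.dist r v = e + 1}, hn,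
    by omega, by omega, ?_, ?_⟩
  · have hw := wienerIndex_add_sum_sq_le hT r
    have hw' : (wienerIndex T : ℚ) + ∑ w with w ≠ r, (descCard T r w : ℚ) ^ 2
        ≤ Fintype.card V * ∑ v with v ≠ r, (T.dist r v : ℚ) := by
      have hsum : ∑ v, T.dist r v = ∑ v with v ≠ r, T.dist r v := by
        rw [sum_filter_of_ne]
        rintro v - hv rfl
        exact hv dist_self
      rw [hsum] at hw
      exact_mod_cast hw
    rw [hunion, sum_union hdisj, sum_union hdisj] at hw'
    have hhalf := halfBroom_add_halfBroom ((c + 1 : ℕ) : ℚ) ((c + 1 + (e + 1) : ℕ) : ℚ) A B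
    have hnq : (A : ℚ) + B + (c + 1 + (e + 1) : ℕ) - 1 = Fintype.card V := by
      have : (Fintype.card V : ℚ) + 1 = A + B + (c + 1 + (e + 1) : ℕ) := by exact_mod_cast hn
      linarith
    have hsub : ((c + 1 + (e + 1) : ℕ) : ℚ) - (c + 1 : ℕ) = (e + 1 : ℕ) := by
      push_cast
      ring
    rw [hnq, hsub] at hhalf
    rw [Nat.cast_sub (by omega), Nat.cast_sub (by omega), ← hhalf]
    linarith
  · intro hP hQ
    have hAe : #{v ∈ L | T.dist r v = c + 1} = A := by omega
    have hBe : #{v ∈ R | T.dist r v = e + 1} = B := by omega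
    refine ⟨h.isBroomProfile (by omega) ?_ ?_, ?_, ?_⟩
    · intro u v hu hv huv hlt
      by_cases hur : u = r
      · subst hur
        rw [dist_self] at huv
        exact hT.connected.dist_eq_zero_iff.1 huv.symm
      · have hvr : v ≠ r := by
          rintro rfl
          rw [dist_self] at huv
          exact hur (hT.connected.dist_eq_zero_iff.1 huv).symm
        exact hL2 (by omega) u ((memL u).2 ⟨hur, hu⟩) v ((memL v).2 ⟨hvr, hv⟩) huv hlt
    · intro u v hu hv huv hlt
      exact hR2 (by omega) u ((memR u).2 hu) v ((memR v).2 hv) huv hlt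
    · rw [← hAe]
      congr 1
      ext v
      rw [mem_filter_univ, mem_filter, memL]
      unfold place
      by_cases hv : IsAncestor T r z v
      · simp [hv]
      · have := h.depth_le_left hv
        simp only [hv, if_false, not_false_eq_true, and_true]
        constructor
        · intro h1
          refine ⟨?_, by omega⟩
          rintro rfl
          rw [dist_self] at h1
          omega
        · rintro ⟨-, h1⟩
          omega
    · rw [← hBe]
      congr 1
      ext v
      rw [mem_filter_univ, mem_filter, memR]
      unfold place
      by_cases hv : IsAncestor T r z v
      · simp only [hv, if_true, true_and]
        omega
      · simp only [hv, if_false, false_and, iff_false]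
        omega

end IsSplit
end Bound

/-! ### Extremal trees and the theorem -/

theorem isDoubleBroom_unique {V : Type u} [Fintype V] {T : SimpleGraph V} {a b A B : ℕ}
    (h : IsDoubleBroom T a b) (h' : IsDoubleBroom T A B) :
    (a = A ∧ b = B) ∨ (a = B ∧ b = A) := by
  obtain ⟨-, -, -, x, y, hxy, hv, hx, hy⟩ := h
  obtain ⟨-, -, -, x', y', hxy', hv', hx', hy'⟩ := h'
  have h1 := (hv' x).1 ((hv x).2 (Or.inl rfl))
  have h2 := (hv' y).1 ((hv y).2 (Or.inr rfl))
  rcases h1 with rfl | rfl <;> rcases h2 with rfl | rfl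
  · exact absurd rfl hxy
  · omega
  · omega
  · exact absurd rfl hxy

open Classical in
/-- The upper bound for the Wiener index of a tree of given order and diameter, and the shape of
the trees attaining it. -/
theorem wienerIndex_le_broomIndex {V : Type u} [Fintype V] {T : SimpleGraph V} {d A₀ B₀ : ℕ}
    (hT : T.IsTree) (hdiam : T.diam = d) (hd : 1501 ≤ d)
    (hV : Fintype.card V + 1 = A₀ + B₀ + d) (hs : (A₀ + B₀ + 1) ^ 2 ≤ 8 * (d - 1))
    (hAB₀ : |(A₀ : ℤ) - B₀| ≤ 1) :
    (wienerIndex T : ℚ) < broomIndex d A₀ B₀ ∨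
      ((wienerIndex T : ℚ) ≤ broomIndex d A₀ B₀ ∧
        ∃ a b : ℕ, IsDoubleBroom T a b ∧ |(a : ℤ) - b| ≤ 1) := by
  -- The two halves differ in length by at most one, as the size conditions of
  -- `IsSplit.wienerIndex_le` need.
  obtain ⟨c, e, hce, h1, h2⟩ : ∃ c e : ℕ, d = c + 1 + (e + 1) ∧ c ≤ e ∧ e ≤ c + 1 :=
    ⟨d / 2 - 1, d - d / 2 - 1, by omega, by omega, by omega⟩
  obtain ⟨x, y, r, z, h⟩ := exists_isSplit (c := c + 1) (e := e + 1) hT (by omega) (by omega)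
  -- The number of leaves is of order at most `√d`; the factor `12` is ample for the size
  -- conditions.
  have hsd : 12 * (A₀ + B₀) ≤ d := by
    by_contra hcon
    zify [show 1 ≤ d by omega] at hs hcon hd
    nlinarith
  obtain ⟨A, B, P, Q, hn, hP, hQ, hW, hprof⟩ := h.wienerIndex_le (by omega) (by omega)
  rw [← hce] at hn hW hprof
  have hs' : A + B = A₀ + B₀ := by omega
  have hnq : (Fintype.card V : ℚ) = A + B + d - 1 := by
    have : (Fintype.card V : ℚ) + 1 = A + B + d := by exact_mod_cast hn
    linarith
  rw [hnq] at hW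
  rcases broomIndex_add_surplus hd (by rwa [hs']) hP hQ hs'.symm hAB₀ with hlt | ⟨hP0, hQ0, hAB⟩
  · exact Or.inl (hW.trans_lt hlt)
  · right
    obtain ⟨hpr, hA, hB⟩ := hprof hP0 hQ0
    refine ⟨?_, A, B, ?_, hAB⟩
    · have heq : broomIndex d A B = broomIndex d A₀ B₀ := by
        rw [abs_le] at hAB hAB₀
        have : (A₀ = A ∧ B₀ = B) ∨ (A₀ = B ∧ B₀ = A) := by omega
        rcases this with ⟨rfl, rfl⟩ | ⟨rfl, rfl⟩
        · rfl
        · exact broomIndex_comm _ _ _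
      rw [hP0, hQ0] at hW
      simpa [heq] using hW
    · rw [← hA, ← hB]
      exact hpr.isDoubleBroom hT (by omega)

open Classical in
theorem broomIndex_le_of_isDoubleBroom {V : Type u} [Fintype V] {T : SimpleGraph V} {a b d : ℕ}
    (hT : IsDoubleBroom T a b) (hdiam : T.diam = d) (hd : 4 ≤ d) :
    Fintype.card V + 1 = a + b + d ∧ broomIndex d a b ≤ wienerIndex T := by
  -- Any split with both parts at least two recovers the profile of a double broom; this one exists
  -- because `d ≥ 4`.
  obtain ⟨x, y, r, z, h⟩ := exists_isSplit (c := 2) (e := d - 2) hT.1 (by omega) (by omega)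
  have hpr := h.isBroomProfile_of_isDoubleBroom (by omega) (by omega) hT
  rw [show 2 + (d - 2) = d by omega] at hpr
  have hn := hpr.card_eq (by omega)
  have hW := hpr.broomIndex_le_wienerIndex hT.1.connected (by omega)
  rcases isDoubleBroom_unique hT (hpr.isDoubleBroom hT.1 (by omega)) with ⟨h1, h2⟩ | ⟨h1, h2⟩
  · rw [h1, h2]
    exact ⟨hn, hW⟩
  · rw [h1, h2, broomIndex_comm]
    exact ⟨by omega, hW⟩

end WienerTree

theorem mainTheorem1 {V : Type u} [Fintype V] (T : SimpleGraph V) (n d : ℕ)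
    (hT : WienerTree.IsTreeOfOrderDiam T n d)
    (hnd : (n : ℤ) ≤ (d : ℤ) - 2 + 4 * ⌊√(((d : ℝ) - 1) / 2)⌋)
    (hn : 1636 ≤ n) :
    WienerTree.HasMaxWienerIndex T n d ↔
      ∃ a b : ℕ, WienerTree.IsDoubleBroom T a b ∧ |(a : ℤ) - (b : ℤ)| ≤ 1 := by
  open WienerTree in
  have hT' := hT
  obtain ⟨hTree, hcard, hdiam⟩ := hT'
  have hdn : d + 1 ≤ n := by
    have := hTree.connected.nonempty
    obtain ⟨u, v, huv⟩ := T.exists_dist_eq_diam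
    obtain ⟨p, hp, hl⟩ := hTree.connected.exists_path_of_dist u v
    have := hp.length_lt
    omega
  obtain ⟨hd, hs⟩ := diam_bounds (s := n + 1 - d) (by omega) (by omega) hnd hn
  have hhalf : (n + 1 - d) / 2 + (n + 1 - d - (n + 1 - d) / 2) = n + 1 - d := by omega
  constructor
  · rintro ⟨-, hmax⟩
    rcases wienerIndex_le_broomIndex (A₀ := (n + 1 - d) / 2)
      (B₀ := n + 1 - d - (n + 1 - d) / 2) hTree hdiam hd (by omega) (by rwa [hhalf])
      (by rw [abs_le]; omega) with hlt | ⟨-, hab⟩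
    · exfalso
      -- A balanced double broom on the same vertex set would beat `T`.
      obtain ⟨T', pos, hT', hd', hpos, hA, hB⟩ := exists_isBroomProfile (V := V) (d := d)
        (a := (n + 1 - d) / 2) (b := n + 1 - d - (n + 1 - d) / 2) (by omega) (by omega) (by omega)
        (by omega)
      have h1 := hmax V T' ⟨hT', hcard, hd'⟩
      have h2 := hpos.broomIndex_le_wienerIndex hT'.connected (by omega)
      rw [hA, hB] at h2
      have h3 : (wienerIndex T' : ℚ) ≤ wienerIndex T := by exact_mod_cast h1
      linarith
    · exact hab
  · rintro ⟨a, b, hab, habs⟩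
    refine ⟨hT, fun V' _ T' hT' => ?_⟩
    obtain ⟨hTree', hcard', hdiam'⟩ := hT'
    obtain ⟨h1, h2⟩ := broomIndex_le_of_isDoubleBroom hab hdiam (by omega)
    have h3 : a + b = n + 1 - d := by omega
    have h4 : (wienerIndex T' : ℚ) ≤ broomIndex d a b := by
      rcases wienerIndex_le_broomIndex hTree' hdiam' hd (by omega) (by rwa [h3]) habs with h | h
      · exact h.le
      · exact h.1
    exact_mod_cast h4.trans h2
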